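/- **Theorem.** A *finite hypergraph* $(E,V)$ is a map $h:E\to P(V)$ from a finite set $E$ of edges to the power set of a finite set $V$ of vertices. Let $H^\circ$ be the $\mathbb Q$-vector space with basis the isomorphism classes of finite hypergraphs all of whose edges have a non-empty vertex set, with product $\mu$ given by disjoint union (unit: the hypergraph $(\emptyset,\emptyset)$), and with the two coproducts $$\Delta(E,V)=\sum_{U\subseteq V}(E_{|U},U)\otimes(E_{|U^c},U^c),\qquad \delta(E,V)=\sum_{F\subseteq E}(F,V)\otimes(F^c,V/F),$$ where $E_{|U}=\{e\in E: h(e)\subseteq U\}$, complements are taken in $V$ resp. $E$, $V/F$ is the quotient of $V$ by the equivalence relation generated by $u\sim u'$ whenever $u,u'\in h(e)$ for some $e\in F$, and an edge $e\in F^c$ of $(F^c,V/F)$ has as vertex set the image of $h(e)$ in $V/F$. The counit $\epsilon_\Delta$ of $\Delta$ is $1$ on hypergraphs with $V=\emptyset$ and $0$ on the others; the counit $\epsilon_\delta$ of $\delta$ is $1$ on hypergraphs with $E=\emptyset$ and $0$ on the others. On $\mathbb Q[x]$ let $\Delta,\delta,\epsilon_\Delta,\epsilon_\delta$ be the algebra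 morphisms with $\Delta(x)=x\otimes1+1\otimes x$, $\delta(x)=x\otimes x$, $\epsilon_\Delta(x)=0$, $\epsilon_\delta(x)=1$. A *double bialgebra* is an algebra $(B,\mu)$ (here commutative, over $\mathbb Q$) with coproducts $\Delta,\delta$ and counits $\epsilon_\Delta,\epsilon_\delta$ such that $(B,\mu,\Delta,\epsilon_\Delta)$ and $(B,\mu,\delta,\epsilon_\delta)$ are bialgebras, $(\mathrm{id}\otimes\epsilon_\Delta)\circ\delta=\eta\circ\epsilon_\Delta$ (where $\eta$ is the unit), and $(\mathrm{id}\otimes\Delta)\circ\delta=m_{13,2,4}\circ(\delta\otimes\delta)\circ\Delta$, where $m_{13,2,4}(a\otimes b\otimes c\otimes d)=ac\otimes b\otimes d$. A morphism of double bialgebras is an algebra morphism compatible with both coproducts and both counits. Then $(H^\circ,\mu,\Delta,\delta)$ and $(\mathbb Q[x],\mu,\Delta,\delta)$ are double bialgebras, there is exactly one morphism of double bialgebras $\chi^\circ:H^\circ\to\mathbb Q[x]$, and for every finite hypergraph $(E,V)$ without empty edges $\chi^\circ(E,V)$ is the chromatic polynomial of $(E,V)$: for every integer $n\ge 0$ the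 value $\chi^\circ(E,V)(n)$ is the number of maps from $V$ to a set of $n$ colours for which no edge is monochromatic (i.e. no edge has all its vertices of the same colour). -/

import Mathlib

open scoped TensorProduct Polynomial

noncomputable section

/-- A finite hypergraph: a map `edge` from a finite set `E` of edges to the set of subsets of a
finite set `V` of vertices.  The map is arbitrary: repeated edges and empty edges are allowed. -/
structure FinHypergraph : Type 1 where
  V : Type
  E : Type
  edge : E → Set V
  [finite_V : Finite V]
  [finite_E : Finite E]

namespace FinHypergraph

attribute [instance] finite_V finite_E

/-- Isomorphisms of hypergraphs: bijections on vertices and on edges preserving incidence. -/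
structure Iso (G K : FinHypergraph) where
  onV : G.V ≃ K.V
  onE : G.E ≃ K.E
  mem_iff : ∀ e v, onV v ∈ K.edge (onE e) ↔ v ∈ G.edge e

namespace Iso

variable {G K L : FinHypergraph}

def refl (G : FinHypergraph) : Iso G G := ⟨Equiv.refl _, Equiv.refl _, fun _ _ => Iff.rfl⟩

def symm (f : Iso G K) : Iso K G :=
  ⟨f.onV.symm, f.onE.symm, fun e v => by
    have := f.mem_iff (f.onE.symm e) (f.onV.symm v)
    simpa using this.symm⟩

def trans (f : Iso G K) (g : Iso K L) : Iso G L :=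
  ⟨f.onV.trans g.onV, f.onE.trans g.onE, fun e v => by
    simp [g.mem_iff, f.mem_iff]⟩

end Iso

/-- The empty hypergraph `(∅, ∅)`. -/
def empty : FinHypergraph := ⟨Empty, Empty, fun e => e.elim⟩

/-- The disjoint union `(E ⊔ E', V ⊔ V', h ⊔ h')`. -/
def disjUnion (G K : FinHypergraph) : FinHypergraph where
  V := G.V ⊕ K.V
  E := G.E ⊕ K.E
  edge := fun e => {x | match e, x with
    | .inl e, .inl v => v ∈ G.edge e
    | .inr e, .inr v => v ∈ K.edge e
    | _, _ => False}

/-- The restriction `(E_{|U}, U)`, where `E_{|U}` consists of the edges contained in `U`. -/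
def restrict (G : FinHypergraph) (U : Set G.V) : FinHypergraph where
  V := U
  E := {e : G.E // G.edge e ⊆ U}
  edge := fun e => {u : U | (u : G.V) ∈ G.edge e.1}

/-- The sub-hypergraph `(F, V)` with edge set `F ⊆ E` and with all vertices. -/
def keep (G : FinHypergraph) (F : Set G.E) : FinHypergraph where
  V := G.V
  E := F
  edge := fun e => G.edge e.1

/-- The equivalence relation on the vertices generated by `u ∼ u'` if `u` and `u'` are on a
common edge belonging to `F`. -/
def contractSetoid (G : FinHypergraph) (F : Set G.E) : Setoid G.V :=
  Relation.EqvGen.setoid fun u u' => ∃ e ∈ F, u ∈ G.edge e ∧ u' ∈ G.edge e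

/-- The contraction `(Fᶜ, V/F)`: its vertices are the equivalence classes for the relation above
(the connected components of `(F, V)`, a vertex on no edge of `F` being alone in its class), its
edges are the edges not in `F`, each with its image in `V/F` as vertex set. -/
def contract (G : FinHypergraph) (F : Set G.E) : FinHypergraph where
  V := Quotient (G.contractSetoid F)
  E := (Fᶜ : Set G.E)
  edge := fun e => Quotient.mk (G.contractSetoid F) '' G.edge e.1

/-- A coloring by `C` is a map from the vertices to `C` for which no edge is monochromatic. -/
def Coloring (G : FinHypergraph) (C : Type) : Type :=
  {c : G.V → C // ∀ e, ¬ ∀ u ∈ G.edge e, ∀ v ∈ G.edge e, c u = c v}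

/-- `p` is the chromatic polynomial of `G`: for every natural number `n`, the value `p(n)` is the
number of colorings of `G` with `n` colors. (There is at most one such `p`.) -/
def IsChromaticPolynomial (G : FinHypergraph) (p : ℚ[X]) : Prop :=
  ∀ n : ℕ, p.eval (n : ℚ) = (Nat.card (G.Coloring (Fin n)) : ℚ)

/-- No edge has an empty vertex set. -/
def NoEmptyEdge (G : FinHypergraph) : Prop := ∀ e, (G.edge e).Nonempty

section IsoLemmas

variable {G K : FinHypergraph}

def disjUnionIso {G' K' : FinHypergraph} (f : Iso G G') (g : Iso K K') :
    Iso (G.disjUnion K) (G'.disjUnion K') :=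
  ⟨Equiv.sumCongr f.onV g.onV, Equiv.sumCongr f.onE g.onE, by
    rintro (e | e) (v | v)
    · exact f.mem_iff e v
    · exact Iff.rfl
    · exact Iff.rfl
    · exact g.mem_iff e v⟩

def disjUnionComm (G K : FinHypergraph) : Iso (G.disjUnion K) (K.disjUnion G) :=
  ⟨Equiv.sumComm _ _, Equiv.sumComm _ _, by
    rintro (e | e) (v | v) <;> exact Iff.rfl⟩

def disjUnionAssoc (G K L : FinHypergraph) :
    Iso ((G.disjUnion K).disjUnion L) (G.disjUnion (K.disjUnion L)) :=
  ⟨Equiv.sumAssoc _ _ _, Equiv.sumAssoc _ _ _, by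
    rintro ((e | e) | e) ((v | v) | v) <;> exact Iff.rfl⟩

def emptyDisjUnion (G : FinHypergraph) : Iso (empty.disjUnion G) G :=
  ⟨Equiv.emptySum Empty _, Equiv.emptySum Empty _, by
    rintro (e | e) (v | v)
    · exact e.elim
    · exact e.elim
    · exact v.elim
    · exact Iff.rfl⟩

theorem Iso.subset_iff (f : Iso G K) (U : Set G.V) (e : G.E) :
    K.edge (f.onE e) ⊆ f.onV '' U ↔ G.edge e ⊆ U := by
  constructor
  · intro h v hv
    obtain ⟨w, hw, hwv⟩ := h ((f.mem_iff e v).2 hv)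
    rwa [← f.onV.injective hwv]
  · intro h w hw
    refine ⟨f.onV.symm w, h ?_, by simp⟩
    rw [← f.mem_iff]
    simpa using hw

def restrictIso (f : Iso G K) (U : Set G.V) : Iso (G.restrict U) (K.restrict (f.onV '' U)) :=
  ⟨f.onV.image U, f.onE.subtypeEquiv fun e => (f.subset_iff U e).symm, by
    intro e v
    exact f.mem_iff e.1 v.1⟩

def keepIso (f : Iso G K) (F : Set G.E) : Iso (G.keep F) (K.keep (f.onE '' F)) :=
  ⟨f.onV, f.onE.image F, by
    intro e v
    exact f.mem_iff e.1 v⟩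

theorem Iso.contractSetoid_le (f : Iso G K) (F : Set G.E) {u v : G.V}
    (h : (G.contractSetoid F).r u v) :
    (K.contractSetoid (f.onE '' F)).r (f.onV u) (f.onV v) := by
  induction h with
  | rel x y h =>
    obtain ⟨e, he, hx, hy⟩ := h
    exact .rel _ _ ⟨f.onE e, ⟨e, he, rfl⟩, (f.mem_iff e x).2 hx, (f.mem_iff e y).2 hy⟩
  | refl x => exact .refl _
  | symm x y _ ih => exact .symm _ _ ih
  | trans x y z _ _ ih₁ ih₂ => exact .trans _ _ _ ih₁ ih₂

theorem Iso.contractSetoid_iff (f : Iso G K) (F : Set G.E) (u v : G.V) :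
    (G.contractSetoid F).r u v ↔
      (K.contractSetoid (f.onE '' F)).r (f.onV u) (f.onV v) := by
  refine ⟨f.contractSetoid_le F, fun h => ?_⟩
  have h' := f.symm.contractSetoid_le _ h
  have hF : f.symm.onE '' (f.onE '' F) = F := f.onE.symm_image_image F
  rw [hF] at h'
  simpa [Iso.symm] using h'

def contractIso (f : Iso G K) (F : Set G.E) :
    Iso (G.contract F) (K.contract (f.onE '' F)) :=
  ⟨Quotient.congr f.onV (f.contractSetoid_iff F),
    f.onE.subtypeEquiv fun e => by simp,
    by
      intro e v
      induction v using Quotient.inductionOn with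
      | h v =>
        constructor
        · rintro ⟨w, hw, hwv⟩
          refine ⟨f.onV.symm w, ?_, ?_⟩
          · rw [← f.mem_iff, Equiv.apply_symm_apply]
            exact hw
          · refine Quotient.sound ((f.contractSetoid_iff F _ _).2 ?_)
            have := Quotient.exact hwv
            simpa using this
        · rintro ⟨w, hw, hwv⟩
          exact ⟨f.onV w, (f.mem_iff _ _).2 hw,
            Quotient.sound ((f.contractSetoid_iff F _ _).1 (Quotient.exact hwv))⟩⟩

end IsoLemmas

end FinHypergraph

/-- Finite hypergraphs without empty edges. -/
def EdgyHypergraph : Type 1 := {G : FinHypergraph // G.NoEmptyEdge}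

namespace EdgyHypergraph

open FinHypergraph

def empty : EdgyHypergraph := ⟨FinHypergraph.empty, fun e => e.elim⟩

def disjUnion (G K : EdgyHypergraph) : EdgyHypergraph :=
  ⟨G.1.disjUnion K.1, by
    rintro (e | e)
    · obtain ⟨v, hv⟩ := G.2 e
      exact ⟨.inl v, hv⟩
    · obtain ⟨v, hv⟩ := K.2 e
      exact ⟨.inr v, hv⟩⟩

def restrict (G : EdgyHypergraph) (U : Set G.1.V) : EdgyHypergraph :=
  ⟨G.1.restrict U, fun e => by
    obtain ⟨v, hv⟩ := G.2 e.1
    exact ⟨⟨v, e.2 hv⟩, hv⟩⟩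

def keep (G : EdgyHypergraph) (F : Set G.1.E) : EdgyHypergraph :=
  ⟨G.1.keep F, fun e => G.2 e.1⟩

def contract (G : EdgyHypergraph) (F : Set G.1.E) : EdgyHypergraph :=
  ⟨G.1.contract F, fun e => (G.2 e.1).image _⟩

instance isoSetoid : Setoid EdgyHypergraph where
  r G K := Nonempty (Iso G.1 K.1)
  iseqv := ⟨fun G => ⟨Iso.refl G.1⟩, fun ⟨f⟩ => ⟨f.symm⟩, fun ⟨f⟩ ⟨g⟩ => ⟨f.trans g⟩⟩

end EdgyHypergraph

/-- Isomorphism classes of finite hypergraphs without empty edges. -/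
def HypClass : Type 1 := Quotient EdgyHypergraph.isoSetoid

namespace HypClass

open FinHypergraph

def mk (G : EdgyHypergraph) : HypClass := Quotient.mk _ G

theorem mk_eq {G K : EdgyHypergraph} (f : Iso G.1 K.1) : mk G = mk K := Quotient.sound ⟨f⟩

/-- Isomorphism classes form a commutative monoid under disjoint union. -/
instance : CommMonoid HypClass where
  mul := Quotient.map₂ EdgyHypergraph.disjUnion
    fun _ _ ⟨f⟩ _ _ ⟨g⟩ => ⟨disjUnionIso f g⟩
  one := mk EdgyHypergraph.empty
  mul_assoc a b c := by
    induction a using Quotient.inductionOn with | h a => ?_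
    induction b using Quotient.inductionOn with | h b => ?_
    induction c using Quotient.inductionOn with | h c => ?_
    exact mk_eq (disjUnionAssoc a.1 b.1 c.1)
  mul_comm a b := by
    induction a using Quotient.inductionOn with | h a => ?_
    induction b using Quotient.inductionOn with | h b => ?_
    exact mk_eq (disjUnionComm a.1 b.1)
  one_mul a := by
    induction a using Quotient.inductionOn with | h a => ?_
    exact mk_eq (emptyDisjUnion a.1)
  mul_one a := by
    induction a using Quotient.inductionOn with | h a => ?_
    exact mk_eq ((disjUnionComm a.1 FinHypergraph.empty).trans (emptyDisjUnion a.1))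

end HypClass

/-- The algebra `H°`: the rational vector space with basis the isomorphism classes of finite
hypergraphs without empty edges, with disjoint union as product and the empty hypergraph as unit. -/
abbrev HypAlg : Type 1 := MonoidAlgebra ℚ HypClass

namespace HypAlg

open FinHypergraph

/-- The basis element of `H°` given by a hypergraph. -/
def ofHyp (G : EdgyHypergraph) : HypAlg := MonoidAlgebra.of ℚ HypClass (HypClass.mk G)

theorem ofHyp_eq {G K : EdgyHypergraph} (f : Iso G.1 K.1) : ofHyp G = ofHyp K :=
  congrArg (MonoidAlgebra.of ℚ HypClass) (HypClass.mk_eq f)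

/-- The linear map out of `H°` with prescribed values on the basis of isomorphism classes. -/
def linearLift {M : Type*} [AddCommGroup M] [Module ℚ M] (f : HypClass → M) : HypAlg →ₗ[ℚ] M :=
  Finsupp.linearCombination ℚ f ∘ₗ (MonoidAlgebra.coeffLinearEquiv ℚ).toLinearMap

/-- `∑_{U ⊆ V} (E_{|U}, U) ⊗ (E_{|Uᶜ}, Uᶜ)` (a finite sum). -/
def resSum (G : EdgyHypergraph) : HypAlg ⊗[ℚ] HypAlg :=
  ∑ᶠ U : Set G.1.V, ofHyp (G.restrict U) ⊗ₜ[ℚ] ofHyp (G.restrict Uᶜ)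

/-- `∑_{F ⊆ E} (F, V) ⊗ (Fᶜ, V/F)` (a finite sum). -/
def extSum (G : EdgyHypergraph) : HypAlg ⊗[ℚ] HypAlg :=
  ∑ᶠ F : Set G.1.E, ofHyp (G.keep F) ⊗ₜ[ℚ] ofHyp (G.contract F)

theorem resSum_congr {G K : EdgyHypergraph} (f : Iso G.1 K.1) : resSum G = resSum K := by
  unfold resSum
  rw [← finsum_comp_equiv (Equiv.Set.congr f.onV)]
  refine finsum_congr fun U => ?_
  have h₁ : ofHyp (G.restrict U) = ofHyp (K.restrict (f.onV '' U)) :=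
    ofHyp_eq (restrictIso f U)
  have h₂ : ofHyp (G.restrict Uᶜ) = ofHyp (K.restrict (f.onV '' Uᶜ)) :=
    ofHyp_eq (restrictIso f Uᶜ)
  rw [Set.image_compl_eq f.onV.bijective] at h₂
  rw [h₁, h₂]
  rfl

theorem extSum_congr {G K : EdgyHypergraph} (f : Iso G.1 K.1) : extSum G = extSum K := by
  unfold extSum
  rw [← finsum_comp_equiv (Equiv.Set.congr f.onE)]
  refine finsum_congr fun F => ?_
  have h₁ : ofHyp (G.keep F) = ofHyp (K.keep (f.onE '' F)) := ofHyp_eq (keepIso f F)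
  have h₂ : ofHyp (G.contract F) = ofHyp (K.contract (f.onE '' F)) :=
    ofHyp_eq (contractIso f F)
  rw [h₁, h₂]
  rfl

/-- The restriction coproduct `Δ (E, V) = ∑_{U ⊆ V} (E_{|U}, U) ⊗ (E_{|Uᶜ}, Uᶜ)` on `H°`. -/
def comulRes : HypAlg →ₗ[ℚ] HypAlg ⊗[ℚ] HypAlg :=
  linearLift (Quotient.lift resSum fun _ _ ⟨f⟩ => resSum_congr f)

/-- The extraction-contraction coproduct `δ (E, V) = ∑_{F ⊆ E} (F, V) ⊗ (Fᶜ, V/F)` on `H°`. -/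
def comulExt : HypAlg →ₗ[ℚ] HypAlg ⊗[ℚ] HypAlg :=
  linearLift (Quotient.lift extSum fun _ _ ⟨f⟩ => extSum_congr f)

open Classical in
/-- The counit of `Δ`: it is `1` on hypergraphs without vertices, `0` on the others. -/
def counitRes : HypAlg →ₗ[ℚ] ℚ :=
  linearLift (Quotient.lift (fun G : EdgyHypergraph => if IsEmpty G.1.V then (1 : ℚ) else 0)
    fun _ _ ⟨f⟩ => by simp only [f.onV.isEmpty_congr])

open Classical in
/-- The counit of `δ`: it is `1` on hypergraphs without edges, `0` on the others. -/
def counitExt : HypAlg →ₗ[ℚ] ℚ :=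
  linearLift (Quotient.lift (fun G : EdgyHypergraph => if IsEmpty G.1.E then (1 : ℚ) else 0)
    fun _ _ ⟨f⟩ => by simp only [f.onE.isEmpty_congr])

end HypAlg

/-- The four structure maps of a double bialgebra (in addition to those of the algebra `B`):
two coproducts `Δ`, `δ` and their counits `εΔ`, `εδ`. -/
structure DoubleComul (B : Type*) [CommRing B] [Algebra ℚ B] where
  Δ : B →ₗ[ℚ] B ⊗[ℚ] B
  εΔ : B →ₗ[ℚ] ℚ
  δ : B →ₗ[ℚ] B ⊗[ℚ] B
  εδ : B →ₗ[ℚ] ℚ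

/-- The algebra `B`, the coproduct `Δ` and the counit `ε` form a bialgebra. -/
structure IsBialgebra {B : Type*} [CommRing B] [Algebra ℚ B]
    (Δ : B →ₗ[ℚ] B ⊗[ℚ] B) (ε : B →ₗ[ℚ] ℚ) : Prop where
  coassoc : (TensorProduct.assoc ℚ B B B).toLinearMap ∘ₗ Δ.rTensor B ∘ₗ Δ = Δ.lTensor B ∘ₗ Δ
  counit_left : (TensorProduct.lid ℚ B).toLinearMap ∘ₗ ε.rTensor B ∘ₗ Δ = LinearMap.id
  counit_right : (TensorProduct.rid ℚ B).toLinearMap ∘ₗ ε.lTensor B ∘ₗ Δ = LinearMap.id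
  comul_one : Δ 1 = 1
  comul_mul : ∀ a b, Δ (a * b) = Δ a * Δ b
  counit_one : ε 1 = 1
  counit_mul : ∀ a b, ε (a * b) = ε a * ε b

/-- The map `m_{13,2,4} : B ⊗ B ⊗ B ⊗ B → B ⊗ B ⊗ B`,
`(a ⊗ b) ⊗ (c ⊗ d) ↦ a c ⊗ (b ⊗ d)`. -/
def mulOneThree (B : Type*) [CommRing B] [Algebra ℚ B] :
    (B ⊗[ℚ] B) ⊗[ℚ] (B ⊗[ℚ] B) →ₗ[ℚ] B ⊗[ℚ] (B ⊗[ℚ] B) :=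
  (LinearMap.mul' ℚ B).rTensor (B ⊗[ℚ] B) ∘ₗ
    (TensorProduct.tensorTensorTensorComm ℚ B B B B).toLinearMap

/-- The laws of a double bialgebra: `(B, μ, Δ)` and `(B, μ, δ)` are bialgebras, and they
cointeract, that is, `εΔ` and `Δ` are morphisms of comodules over `(B, μ, δ)`. (The unit and the
multiplication then are comodule morphisms as well, since `δ` is multiplicative.) -/
structure DoubleComul.IsDoubleBialgebra {B : Type*} [CommRing B] [Algebra ℚ B]
    (S : DoubleComul B) : Prop where
  bialgebra_Δ : IsBialgebra S.Δ S.εΔ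
  bialgebra_δ : IsBialgebra S.δ S.εδ
  counit_comodule : (TensorProduct.rid ℚ B).toLinearMap ∘ₗ S.εΔ.lTensor B ∘ₗ S.δ =
    Algebra.linearMap ℚ B ∘ₗ S.εΔ
  comul_comodule : S.Δ.lTensor B ∘ₗ S.δ =
    mulOneThree B ∘ₗ TensorProduct.map S.δ S.δ ∘ₗ S.Δ

/-- Morphisms of double bialgebras: algebra morphisms compatible with both coproducts and with
both counits. -/
structure IsDoubleBialgebraHom {B C : Type*} [CommRing B] [Algebra ℚ B] [CommRing C] [Algebra ℚ C]
    (S : DoubleComul B) (T : DoubleComul C) (φ : B →ₐ[ℚ] C) : Prop where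
  map_Δ : T.Δ ∘ₗ φ.toLinearMap = TensorProduct.map φ.toLinearMap φ.toLinearMap ∘ₗ S.Δ
  map_εΔ : T.εΔ ∘ₗ φ.toLinearMap = S.εΔ
  map_δ : T.δ ∘ₗ φ.toLinearMap = TensorProduct.map φ.toLinearMap φ.toLinearMap ∘ₗ S.δ
  map_εδ : T.εδ ∘ₗ φ.toLinearMap = S.εδ

/-- The structure maps of the double bialgebra of hypergraphs `(H°, μ, Δ, δ)`. -/
def hypDouble : DoubleComul HypAlg where
  Δ := HypAlg.comulRes
  εΔ := HypAlg.counitRes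
  δ := HypAlg.comulExt
  εδ := HypAlg.counitExt

open Polynomial in
/-- The structure maps of the double bialgebra `(ℚ[x], μ, Δ, δ)`: all four are the algebra
morphisms determined by `Δ x = x ⊗ 1 + 1 ⊗ x`, `εΔ x = 0`, `δ x = x ⊗ x`, `εδ x = 1`. -/
def polyDouble : DoubleComul ℚ[X] where
  Δ := (aeval (X ⊗ₜ[ℚ] 1 + 1 ⊗ₜ[ℚ] X : ℚ[X] ⊗[ℚ] ℚ[X])).toLinearMap
  εΔ := (aeval (0 : ℚ)).toLinearMap
  δ := (aeval (X ⊗ₜ[ℚ] X : ℚ[X] ⊗[ℚ] ℚ[X])).toLinearMap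
  εδ := (aeval (1 : ℚ)).toLinearMap

end

open scoped TensorProduct Polynomial

/-! The axioms for H° are linear identities, so each is tested on a basis hypergraph. There both
sides are finite sums, and each proof consists of a bijection of index sets together with an
isomorphism of hypergraphs for each summand. Coassociativity of Δ compares ordered partitions of V
into three blocks; coassociativity of δ compares chains F' ⊆ F of edge sets and rests on contraction
in stages. For the cointeraction, both sides become sums over the pairs (U, F) such that no edge of
F meets both U and its complement. Such a U is a union of classes of V/F, and such an F splits into
edges of the two restrictions. The splitting is unique because an edge is non-empty.

An element of ℚ[x] ⊗ ℚ[x] is determined by its values at pairs (m, n) of natural numbers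
(`tensor_ext_of_evalTensor`). At such a pair Δ p takes the value p(m + n) and δ p the value p(mn),
while the counits are evaluation at 0 and at 1. Thus the chromatic polynomial defines a morphism
because of two bijections. A colouring by C ⊕ D amounts to a set U of vertices with colourings of
the restrictions to U and to its complement (`glueColoring_bijective`). A colouring by C × D amounts
to a set F of edges, those monochromatic in the second coordinate, with a colouring of (F, V) by C
and one of the contraction by D (`pairColoring_bijective`). That the counts are polynomial in the
number of colours is inclusion-exclusion over sets of monochromatic edges.

Uniqueness is an induction on n: the counits fix the values at 0 and 1, and Δ expresses the value at
n + 1 through values at n and 1. -/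

noncomputable section

/-! ### Finite sums over subsets and pairs of subsets -/

section FiniteSums

variable {ι κ M N : Type*} [Finite ι]

theorem map_finsum_of_finite {F : Type*} [AddCommMonoid M] [AddCommMonoid N] [FunLike F M N]
    [AddMonoidHomClass F M N] (g : F) (f : ι → M) : g (∑ᶠ i, f i) = ∑ᶠ i, g (f i) :=
  map_finsum g (Set.toFinite _)

theorem finsum_finsum_sigma_of_finite {β : ι → Type*} [∀ i, Finite (β i)] [AddCommMonoid M]
    (f : ∀ i, β i → M) : ∑ᶠ i, ∑ᶠ j, f i j = ∑ᶠ p : Sigma β, f p.1 p.2 := by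
  have := Fintype.ofFinite ι
  have := fun i => Fintype.ofFinite (β i)
  simp only [finsum_eq_sum_of_fintype]
  rw [Fintype.sum_sigma]

theorem finsum_tmul_finsum_of_finite [Finite κ] [AddCommGroup M] [Module ℚ M] [AddCommGroup N]
    [Module ℚ N] (f : ι → M) (g : κ → N) :
    (∑ᶠ i, f i) ⊗ₜ[ℚ] (∑ᶠ j, g j) = ∑ᶠ p : ι × κ, f p.1 ⊗ₜ[ℚ] g p.2 := by
  have := Fintype.ofFinite ι
  have := Fintype.ofFinite κ
  simp only [finsum_eq_sum_of_fintype, TensorProduct.sum_tmul, TensorProduct.tmul_sum]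
  rw [Fintype.sum_prod_type, Finset.sum_comm]

theorem finsum_mul_finsum_of_finite [Finite κ] [NonUnitalNonAssocSemiring M] (f : ι → M)
    (g : κ → M) : (∑ᶠ i, f i) * (∑ᶠ j, g j) = ∑ᶠ p : ι × κ, f p.1 * g p.2 := by
  have := Fintype.ofFinite ι
  have := Fintype.ofFinite κ
  simp only [finsum_eq_sum_of_fintype, Finset.sum_mul_sum]
  rw [Fintype.sum_prod_type]

/-- A double sum over the subsets `U` and the subsets of `s U` as a sum over pairs of subsets. -/
theorem finsum_finsum_set (s : Set ι → Set ι) [AddCommMonoid M] (f : Set ι → Set ι → M) :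
    ∑ᶠ U, ∑ᶠ W : Set (s U), f U (Subtype.val '' W) =
      ∑ᶠ p : {p : Set ι × Set ι // p.2 ⊆ s p.1}, f p.1.1 p.1.2 := by
  rw [finsum_finsum_sigma_of_finite (β := fun U => Set (s U)) (fun U W => f U (Subtype.val '' W))]
  refine finsum_eq_of_bijective
    (fun q => ⟨(q.1, Subtype.val '' q.2), Subtype.coe_image_subset _ _⟩) ⟨?_, ?_⟩ fun _ => rfl
  · rintro ⟨U, W⟩ ⟨U', W'⟩ h
    simp only [Subtype.mk.injEq, Prod.mk.injEq] at h
    obtain ⟨rfl, h⟩ := h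
    rw [Subtype.val_injective.image_injective h]
  · rintro ⟨⟨U, W⟩, h⟩
    exact ⟨⟨U, Subtype.val ⁻¹' W⟩, by simpa using h⟩

end FiniteSums

/-! ### Linear maps on H° and equality of basis elements -/

namespace HypAlg

open FinHypergraph Function

theorem linearLift_ofHyp {M : Type*} [AddCommGroup M] [Module ℚ M] (f : HypClass → M)
    (G : EdgyHypergraph) : linearLift f (ofHyp G) = f (HypClass.mk G) := by
  simp [linearLift, ofHyp]

theorem linearMap_ext {M : Type*} [AddCommGroup M] [Module ℚ M] {f g : HypAlg →ₗ[ℚ] M}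
    (h : ∀ G, f (ofHyp G) = g (ofHyp G)) : f = g := by
  ext c
  induction c using Quotient.inductionOn with
  | h G => exact h G

theorem ofHyp_mul (G K : EdgyHypergraph) : ofHyp G * ofHyp K = ofHyp (G.disjUnion K) :=
  (map_mul (MonoidAlgebra.of ℚ HypClass) _ _).symm

theorem ofHyp_empty : ofHyp EdgyHypergraph.empty = 1 :=
  map_one (MonoidAlgebra.of ℚ HypClass)

theorem comulRes_ofHyp (G : EdgyHypergraph) : comulRes (ofHyp G) = resSum G :=
  linearLift_ofHyp _ _

theorem comulExt_ofHyp (G : EdgyHypergraph) : comulExt (ofHyp G) = extSum G :=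
  linearLift_ofHyp _ _

open Classical in
theorem counitRes_ofHyp (G : EdgyHypergraph) :
    counitRes (ofHyp G) = if IsEmpty G.1.V then 1 else 0 :=
  linearLift_ofHyp _ _

open Classical in
theorem counitExt_ofHyp (G : EdgyHypergraph) :
    counitExt (ofHyp G) = if IsEmpty G.1.E then 1 else 0 :=
  linearLift_ofHyp _ _

/-- Both sides are bilinear: extend from the basis in the second factor with the first a basis
element, then in the first. -/
theorem map_mul_of_ofHyp {B : Type*} [CommRing B] [Algebra ℚ B] (f : HypAlg →ₗ[ℚ] B)
    (h : ∀ G K, f (ofHyp (G.disjUnion K)) = f (ofHyp G) * f (ofHyp K)) (a b : HypAlg) :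
    f (a * b) = f a * f b := by
  have hG : ∀ G, f ∘ₗ LinearMap.mulLeft ℚ (ofHyp G) = LinearMap.mulLeft ℚ (f (ofHyp G)) ∘ₗ f :=
    fun G => linearMap_ext fun K => by simpa [ofHyp_mul] using h G K
  have hb : f ∘ₗ LinearMap.mulRight ℚ b = LinearMap.mulRight ℚ (f b) ∘ₗ f :=
    linearMap_ext fun G => LinearMap.congr_fun (hG G) b
  exact LinearMap.congr_fun hb a

/-- Two hypergraphs which are quotients of the same edge data, with the same vertices identified,
have the same class. -/
theorem ofHyp_eq_of_presentation {G K : EdgyHypergraph} {X Y : Type*} (h : Y → Set X)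
    {p : X → G.1.V} {p' : X → K.1.V} {q : Y → G.1.E} {q' : Y → K.1.E}
    (hp : Surjective p) (hp' : Surjective p') (hq : Bijective q) (hq' : Bijective q')
    (hker : ∀ x y, p x = p y ↔ p' x = p' y)
    (hG : ∀ y, G.1.edge (q y) = p '' h y) (hK : ∀ y, K.1.edge (q' y) = p' '' h y) :
    ofHyp G = ofHyp K := by
  -- The bijection on vertices lifts a vertex along p and applies p'; equality of kernels makes the
  -- choice of lift irrelevant.
  have key : ∀ x, p' (surjInv hp (p x)) = p' x := fun x => (hker _ _).1 (surjInv_eq hp _)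
  have bij : Bijective fun v => p' (surjInv hp v) := by
    refine ⟨fun u v huv => ?_, fun w => ?_⟩
    · have := (hker _ _).2 huv
      rwa [surjInv_eq hp, surjInv_eq hp] at this
    · obtain ⟨x, rfl⟩ := hp' w
      exact ⟨p x, key x⟩
  refine ofHyp_eq ⟨.ofBijective _ bij, (Equiv.ofBijective q hq).symm.trans (.ofBijective q' hq'), ?_⟩
  intro e v
  obtain ⟨y, rfl⟩ := hq.2 e
  obtain ⟨x, rfl⟩ := hp v
  have : (Equiv.ofBijective q hq).symm (q y) = y := (Equiv.ofBijective q hq).symm_apply_apply y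
  simp only [Equiv.trans_apply, this, Equiv.ofBijective_apply, key, hG, hK, Set.mem_image]
  exact ⟨fun ⟨z, hz, hzx⟩ => ⟨z, hz, (hker _ _).2 hzx⟩, fun ⟨z, hz, hzx⟩ => ⟨z, hz, (hker _ _).1 hzx⟩⟩

theorem ofHyp_eq_of_bijective {G K : EdgyHypergraph} {p : G.1.V → K.1.V} {q : G.1.E → K.1.E}
    (hp : Bijective p) (hq : Bijective q) (h : ∀ e v, p v ∈ K.1.edge (q e) ↔ v ∈ G.1.edge e) :
    ofHyp G = ofHyp K :=
  ofHyp_eq ⟨.ofBijective p hp, .ofBijective q hq, h⟩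

end HypAlg

/-! ### Edges of a disjoint union and the universal property of contraction -/

namespace FinHypergraph

variable (G K : FinHypergraph)

theorem disjUnion_edge_inl (e : G.E) :
    (G.disjUnion K).edge (.inl e) = (Sum.inl '' G.edge e : Set (G.V ⊕ K.V)) := by
  ext (v | v)
  · exact ⟨fun h => ⟨v, h, rfl⟩, fun ⟨w, hw, h⟩ => Sum.inl_injective h ▸ hw⟩
  · exact ⟨False.elim, fun ⟨w, _, h⟩ => nomatch h⟩

theorem disjUnion_edge_inr (e : K.E) :
    (G.disjUnion K).edge (.inr e) = (Sum.inr '' K.edge e : Set (G.V ⊕ K.V)) := by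
  ext (v | v)
  · exact ⟨False.elim, fun ⟨w, _, h⟩ => nomatch h⟩
  · exact ⟨fun h => ⟨v, h, rfl⟩, fun ⟨w, hw, h⟩ => Sum.inr_injective h ▸ hw⟩

variable {G K}

/-- The universal property of V/F. With r the kernel of a map, it says that a map descends to V/F
exactly when it is constant on each edge of F; this is how colourings meet contractions. -/
theorem contractSetoid_le_iff {F : Set G.E} {r : Setoid G.V} :
    G.contractSetoid F ≤ r ↔ ∀ e ∈ F, ∀ u ∈ G.edge e, ∀ v ∈ G.edge e, r u v := by
  constructor
  · exact fun h e he u hu v hv => h (.rel _ _ ⟨e, he, hu, hv⟩)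
  · exact fun h => Setoid.eqvGen_le fun u v ⟨e, he, hu, hv⟩ => h e he u hu v hv

theorem contractSetoid_rel {F : Set G.E} {e : G.E} (he : e ∈ F) {u v : G.V} (hu : u ∈ G.edge e)
    (hv : v ∈ G.edge e) : G.contractSetoid F u v :=
  .rel _ _ ⟨e, he, hu, hv⟩

end FinHypergraph

/-! ### The contraction relation under restriction, contraction and disjoint union -/

namespace FinHypergraph

variable {G : FinHypergraph}

theorem contractSetoid_keep (F : Set G.E) (F' : Set F) :
    (G.keep F).contractSetoid F' = G.contractSetoid (Subtype.val '' F') := by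
  refine le_antisymm (contractSetoid_le_iff.2 fun e he u hu v hv => ?_)
    (contractSetoid_le_iff.2 ?_)
  · exact contractSetoid_rel (Set.mem_image_of_mem _ he) hu hv
  · rintro _ ⟨e, he, rfl⟩ u hu v hv
    exact contractSetoid_rel (G := G.keep F) he hu hv

theorem contractSetoid_mono {F F' : Set G.E} (h : F ⊆ F') :
    G.contractSetoid F ≤ G.contractSetoid F' :=
  contractSetoid_le_iff.2 fun _ he _ hu _ hv => contractSetoid_rel (h he) hu hv

/-- Contraction in stages. One direction pulls the relation on V/F back to V; the other uses that
the projection from V/F to the quotient by the larger edge set is constant on the image of each edge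
of S. -/
theorem contractSetoid_contract (F : Set G.E) (S : Set (Fᶜ : Set G.E)) (u v : G.V) :
    G.contractSetoid (F ∪ Subtype.val '' S) u v ↔
      (G.contract F).contractSetoid S (Quotient.mk (G.contractSetoid F) u)
        (Quotient.mk (G.contractSetoid F) v) := by
  constructor
  · revert u v
    refine contractSetoid_le_iff
      (r := ((G.contract F).contractSetoid S).comap (Quotient.mk (G.contractSetoid F))).2 ?_
    rintro e (he | ⟨e, he, rfl⟩) u hu v hv
    · have : Quotient.mk (G.contractSetoid F) u = Quotient.mk (G.contractSetoid F) v :=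
        Quotient.sound (contractSetoid_rel he hu hv)
      change (G.contract F).contractSetoid S (Quotient.mk _ u) (Quotient.mk _ v)
      exact this ▸ Setoid.refl' _ _
    · exact contractSetoid_rel (G := G.contract F) he ⟨u, hu, rfl⟩ ⟨v, hv, rfl⟩
  · intro h
    have hle := contractSetoid_mono (G := G) (F := F) (F' := F ∪ Subtype.val '' S)
      Set.subset_union_left
    let g : Quotient (G.contractSetoid F) → Quotient (G.contractSetoid (F ∪ Subtype.val '' S)) :=
      Quotient.map id hle
    have : (G.contract F).contractSetoid S ≤ Setoid.ker g := by
      refine contractSetoid_le_iff.2 ?_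
      rintro e he _ ⟨u, hu, rfl⟩ _ ⟨v, hv, rfl⟩
      exact Quotient.sound (contractSetoid_rel (Or.inr ⟨e, he, rfl⟩) hu hv)
    exact Quotient.exact (s := G.contractSetoid (F ∪ Subtype.val '' S)) (this h)

/-- No edge of `F` meets both `U` and its complement. -/
def Saturated (G : FinHypergraph) (U : Set G.V) (F : Set G.E) : Prop :=
  ∀ e ∈ F, G.edge e ⊆ U ∨ G.edge e ⊆ Uᶜ

/-- Membership in U is constant on each edge of F, hence on each class. -/
theorem Saturated.mem_iff {U : Set G.V} {F : Set G.E} (h : G.Saturated U F) {u v : G.V}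
    (huv : G.contractSetoid F u v) : u ∈ U ↔ v ∈ U := by
  have : G.contractSetoid F ≤ Setoid.ker (· ∈ U) := by
    refine contractSetoid_le_iff.2 fun e he u hu v hv => propext ?_
    rcases h e he with h | h
    · exact iff_of_true (h hu) (h hv)
    · exact iff_of_false (h hu) (h hv)
  exact iff_of_eq (this huv)

/-- All vertices of an edge of F are in one class, so a union of classes contains or avoids the
edge. Together with `Saturated.preimage_image`, this identifies the subsets of V/F with the sets U
saturated for F. -/
theorem saturated_preimage (F : Set G.E) (U : Set (Quotient (G.contractSetoid F))) :
    G.Saturated (Quotient.mk _ ⁻¹' U) F := by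
  intro e he
  by_cases h : ∃ v ∈ G.edge e, Quotient.mk _ v ∈ U
  · obtain ⟨v, hv, hU⟩ := h
    refine Or.inl fun w hw => ?_
    rw [Set.mem_preimage, Quotient.sound (s := G.contractSetoid F) (contractSetoid_rel he hw hv)]
    exact hU
  · push Not at h
    exact Or.inr h

theorem Saturated.preimage_image {U : Set G.V} {F : Set G.E} (h : G.Saturated U F) :
    Quotient.mk (G.contractSetoid F) ⁻¹' (Quotient.mk (G.contractSetoid F) '' U) = U := by
  ext v
  constructor
  · rintro ⟨u, hu, huv⟩
    exact (h.mem_iff (Quotient.exact huv)).1 hu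
  · exact fun hv => ⟨v, hv, rfl⟩

/-- A chain of edges of F that starts in U never leaves U, so it uses only edges of the restriction.
-/
theorem Saturated.contractSetoid_restrict {U : Set G.V} {F : Set G.E} (h : G.Saturated U F)
    (u v : U) : (G.restrict U).contractSetoid {e | e.1 ∈ F} u v ↔ G.contractSetoid F u v := by
  constructor
  · revert u v
    refine contractSetoid_le_iff (G := G.restrict U)
      (r := (G.contractSetoid F).comap Subtype.val).2 fun e he u hu v hv => ?_
    exact contractSetoid_rel (G := G) he hu hv
  · intro huv
    -- The relation of the restriction, extended to V by identifying all vertices outside U: coarse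
    -- enough to relate the vertices on any edge of F, and unchanged inside U.
    let r : Setoid G.V :=
      { r := fun x y => (x ∈ U ↔ y ∈ U) ∧ ∀ (hx : x ∈ U) (hy : y ∈ U),
          (G.restrict U).contractSetoid {e | e.1 ∈ F} ⟨x, hx⟩ ⟨y, hy⟩
        iseqv :=
          { refl := fun x => ⟨Iff.rfl, fun _ _ => Setoid.refl' _ _⟩
            symm := fun h => ⟨h.1.symm, fun hx hy => Setoid.symm' _ (h.2 hy hx)⟩
            trans := fun h h' => ⟨h.1.trans h'.1, fun hx hy =>
              Setoid.trans' _ (h.2 hx (h.1.1 hx)) (h'.2 (h.1.1 hx) hy)⟩ } }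
    have : G.contractSetoid F ≤ r := by
      refine contractSetoid_le_iff.2 fun e he x hx y hy => ?_
      rcases h e he with hU | hU
      · exact ⟨iff_of_true (hU hx) (hU hy), fun _ _ =>
          contractSetoid_rel (G := G.restrict U) (e := ⟨e, hU⟩) he hx hy⟩
      · exact ⟨iff_of_false (hU hx) (hU hy), fun h => absurd h (hU hx)⟩
    exact (this huv).2 u.2 v.2

/-- Each edge stays within one summand, so no class crosses from one to the other. -/
theorem contractSetoid_disjUnion {G K : FinHypergraph} (S : Set (G.E ⊕ K.E))
    (x y : G.V ⊕ K.V) : (G.disjUnion K).contractSetoid S x y ↔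
      Sum.LiftRel (G.contractSetoid (Sum.inl ⁻¹' S)) (K.contractSetoid (Sum.inr ⁻¹' S)) x y := by
  constructor
  · let r : Setoid (G.V ⊕ K.V) :=
      { r := Sum.LiftRel (G.contractSetoid (Sum.inl ⁻¹' S)) (K.contractSetoid (Sum.inr ⁻¹' S))
        iseqv :=
          { refl := by
              rintro (x | x)
              · exact .inl (Setoid.refl' _ _)
              · exact .inr (Setoid.refl' _ _)
            symm := by
              rintro _ _ (h | h)
              · exact .inl (Setoid.symm' _ h)
              · exact .inr (Setoid.symm' _ h)
            trans := by
              rintro _ _ _ (h | h) (h' | h')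
              · exact .inl (Setoid.trans' _ h h')
              · exact .inr (Setoid.trans' _ h h') } }
    have : (G.disjUnion K).contractSetoid S ≤ r := by
      refine contractSetoid_le_iff.2 ?_
      rintro (e | e) he (x | x) hx (y | y) hy
      · exact .inl (contractSetoid_rel (G := G) he hx hy)
      · exact hy.elim
      · exact hx.elim
      · exact hx.elim
      · exact hx.elim
      · exact hx.elim
      · exact hy.elim
      · exact .inr (contractSetoid_rel (G := K) he hx hy)
    exact fun h => this h
  · rintro (h | h)
    · have : G.contractSetoid (Sum.inl ⁻¹' S) ≤
          ((G.disjUnion K).contractSetoid S).comap Sum.inl := by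
        refine contractSetoid_le_iff.2 ?_
        exact fun e he x hx y hy => contractSetoid_rel (G := G.disjUnion K) (e := .inl e) he hx hy
      exact this h
    · have : K.contractSetoid (Sum.inr ⁻¹' S) ≤
          ((G.disjUnion K).contractSetoid S).comap Sum.inr := by
        refine contractSetoid_le_iff.2 ?_
        exact fun e he x hx y hy => contractSetoid_rel (G := G.disjUnion K) (e := .inr e) he hx hy
      exact this h

end FinHypergraph

/-! ### Isomorphisms between iterated restrictions, extractions and contractions -/

namespace HypAlg

open FinHypergraph Function

variable (G K : EdgyHypergraph)

theorem ofHyp_restrict_restrict (U : Set G.1.V) (W : Set U) :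
    ofHyp ((G.restrict U).restrict W) = ofHyp (G.restrict (Subtype.val '' W)) := by
  refine ofHyp_eq_of_bijective (G := (G.restrict U).restrict W)
    (K := G.restrict (Subtype.val '' W))
    (p := fun w => ⟨w.1.1, w.1, w.2, rfl⟩)
    (q := fun e => ⟨e.1.1, fun v hv => ⟨⟨v, e.1.2 hv⟩, e.2 hv, rfl⟩⟩) ⟨?_, ?_⟩ ⟨?_, ?_⟩ ?_
  · intro u v h
    have h := congrArg Subtype.val h
    exact Subtype.ext (Subtype.ext h)
  · rintro ⟨_, w, hw, rfl⟩
    exact ⟨⟨w, hw⟩, rfl⟩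
  · intro u v h
    have h := congrArg Subtype.val h
    exact Subtype.ext (Subtype.ext h)
  · rintro ⟨e, he⟩
    refine ⟨⟨⟨e, fun v hv => ?_⟩, ?_⟩, rfl⟩
    · obtain ⟨w, _, rfl⟩ := he hv
      exact w.2
    · rintro v hv
      obtain ⟨w, hw, h⟩ := he hv
      rwa [← Subtype.ext h]
  · exact fun e v => Iff.rfl

theorem ofHyp_keep_keep (F : Set G.1.E) (F' : Set F) :
    ofHyp ((G.keep F).keep F') = ofHyp (G.keep (Subtype.val '' F')) := by
  refine ofHyp_eq_of_bijective (G := (G.keep F).keep F')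
    (K := G.keep (Subtype.val '' F')) (p := id)
    (q := fun e => ⟨e.1.1, e.1, e.2, rfl⟩) bijective_id ⟨?_, ?_⟩ ?_
  · intro u v h
    have h := congrArg Subtype.val h
    exact Subtype.ext (Subtype.ext h)
  · rintro ⟨_, w, hw, rfl⟩
    exact ⟨⟨w, hw⟩, rfl⟩
  · exact fun e v => Iff.rfl

/-- Both sides are V modulo the edges of F', with the edges of F outside F'. -/
theorem ofHyp_keep_contract (F : Set G.1.E) (F' : Set F) :
    ofHyp ((G.keep F).contract F') =
      ofHyp ((G.contract (Subtype.val '' F')).keep {e | e.1 ∈ F}) := by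
  refine ofHyp_eq_of_presentation (G := (G.keep F).contract F')
    (K := (G.contract (Subtype.val '' F')).keep {e | e.1 ∈ F}) (X := G.1.V) (Y := (F'ᶜ : Set F))
    (p := Quotient.mk ((G.1.keep F).contractSetoid F'))
    (p' := Quotient.mk (G.1.contractSetoid (Subtype.val '' F')))
    (q := id) (q' := fun e => ⟨⟨e.1.1, fun ⟨e', he', h⟩ => e.2 (Subtype.ext h ▸ he')⟩, e.1.2⟩)
    (fun e => G.1.edge e.1.1)
    Quotient.mk_surjective Quotient.mk_surjective bijective_id ⟨?_, ?_⟩ ?_ ?_ ?_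
  · intro u v h
    exact Subtype.ext (Subtype.ext (congrArg (fun e => e.1.1) h))
  · rintro ⟨⟨e, he⟩, heF⟩
    exact ⟨⟨⟨e, heF⟩, fun h => he ⟨_, h, rfl⟩⟩, rfl⟩
  · intro x y
    refine Quotient.eq.trans (Iff.trans ?_ Quotient.eq.symm)
    exact iff_of_eq (congrArg (fun r : Setoid G.1.V => r x y) (contractSetoid_keep F F'))
  · exact fun _ => rfl
  · exact fun _ => rfl

theorem ofHyp_contract_contract (F : Set G.1.E) (S : Set (Fᶜ : Set G.1.E)) :
    ofHyp ((G.contract F).contract S) = ofHyp (G.contract (F ∪ Subtype.val '' S)) := by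
  refine ofHyp_eq_of_presentation (G := (G.contract F).contract S)
    (K := G.contract (F ∪ Subtype.val '' S)) (X := G.1.V) (Y := (Sᶜ : Set (Fᶜ : Set G.1.E)))
    (p := fun v => Quotient.mk ((G.1.contract F).contractSetoid S)
      (Quotient.mk (G.1.contractSetoid F) v))
    (p' := Quotient.mk (G.1.contractSetoid (F ∪ Subtype.val '' S)))
    (q := id)
    (q' := fun e => ⟨e.1.1, fun h => h.elim e.1.2 fun ⟨e', he', h⟩ => e.2 (Subtype.ext h ▸ he')⟩)
    (fun e => G.1.edge e.1.1)
    (Quotient.mk_surjective.comp Quotient.mk_surjective) Quotient.mk_surjective bijective_id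
    ⟨?_, ?_⟩ ?_ ?_ ?_
  · intro u v h
    exact Subtype.ext (Subtype.ext (congrArg (fun e => e.1) h))
  · rintro ⟨e, he⟩
    exact ⟨⟨⟨e, fun h => he (.inl h)⟩, fun h => he (.inr ⟨_, h, rfl⟩)⟩, rfl⟩
  · intro x y
    refine Quotient.eq.trans (Iff.trans ?_ Quotient.eq.symm)
    exact (contractSetoid_contract F S x y).symm
  · exact fun _ => Set.image_image _ _ _
  · exact fun _ => rfl

/-- The image of an edge lies in U exactly when the edge lies in the preimage of U, and that
preimage is saturated, so restricting first does not change the classes within it. -/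
theorem ofHyp_contract_restrict (F : Set G.1.E) (U : Set (Quotient (G.1.contractSetoid F))) :
    ofHyp ((G.contract F).restrict U) =
      ofHyp ((G.restrict (Quotient.mk _ ⁻¹' U)).contract {e | e.1 ∈ F}) := by
  have hsat := saturated_preimage F U
  refine ofHyp_eq_of_presentation (G := (G.contract F).restrict U)
    (K := (G.restrict (Quotient.mk _ ⁻¹' U)).contract {e | e.1 ∈ F})
    (X := (Quotient.mk (G.1.contractSetoid F) ⁻¹' U : Set G.1.V))
    (Y := ((G.1.contract F).restrict U).E)
    (p := fun v => ⟨Quotient.mk _ v.1, v.2⟩)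
    (p' := Quotient.mk _)
    (q := id)
    (q' := fun e => ⟨⟨e.1.1, Set.image_subset_iff.1 e.2⟩, e.1.2⟩)
    (fun e => {v | v.1 ∈ G.1.edge e.1.1})
    ?_ Quotient.mk_surjective bijective_id ⟨?_, ?_⟩ ?_ ?_ ?_
  · rintro ⟨u, hu⟩
    obtain ⟨v, rfl⟩ := Quotient.mk_surjective u
    exact ⟨⟨v, hu⟩, rfl⟩
  · intro u v h
    exact Subtype.ext (Subtype.ext (congrArg (fun e => e.1.1) h))
  · rintro ⟨⟨e, he⟩, heF⟩
    exact ⟨⟨⟨e, heF⟩, Set.image_subset_iff.2 he⟩, rfl⟩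
  · intro x y
    refine Iff.trans ?_ ((hsat.contractSetoid_restrict x y).symm.trans Quotient.eq.symm)
    exact Subtype.ext_iff.trans Quotient.eq
  · rintro ⟨⟨e, heF⟩, he⟩
    ext ⟨u, hu⟩
    constructor
    · rintro ⟨v, hv, rfl⟩
      exact ⟨⟨v, hu⟩, hv, rfl⟩
    · rintro ⟨v, hv, h⟩
      exact ⟨v.1, hv, congrArg Subtype.val h⟩
  · exact fun _ => rfl

/-- An empty edge would belong to both restrictions and be counted twice in the product;
non-emptiness makes the two edge sets disjoint inside E. -/
theorem ofHyp_restrict_keep_mul (U : Set G.1.V) (F : Set (G.1.restrict U).E)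
    (F' : Set (G.1.restrict Uᶜ).E) :
    ofHyp ((G.restrict U).keep F) * ofHyp ((G.restrict Uᶜ).keep F') =
      ofHyp (G.keep (Subtype.val '' F ∪ Subtype.val '' F')) := by
  classical
  rw [ofHyp_mul]
  have hdisj : ∀ (e : G.1.E), G.1.edge e ⊆ U → ¬ G.1.edge e ⊆ Uᶜ := fun e h h' => by
    obtain ⟨v, hv⟩ := G.2 e
    exact h' hv (h hv)
  refine ofHyp_eq_of_bijective (G := ((G.restrict U).keep F).disjUnion ((G.restrict Uᶜ).keep F'))
    (K := G.keep (Subtype.val '' F ∪ Subtype.val '' F'))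
    (p := Equiv.Set.sumCompl U)
    (q := Sum.elim (fun e => ⟨e.1.1, .inl ⟨e.1, e.2, rfl⟩⟩) fun e => ⟨e.1.1, .inr ⟨e.1, e.2, rfl⟩⟩)
    (Equiv.bijective _) ⟨?_, ?_⟩ ?_
  · rintro (e | e) (e' | e') h
    · have h := congrArg Subtype.val h
      exact congrArg Sum.inl (Subtype.ext (Subtype.ext h))
    · have h : e.1.1 = e'.1.1 := congrArg Subtype.val h
      exact absurd e'.1.2 (h ▸ hdisj _ e.1.2)
    · have h : e.1.1 = e'.1.1 := congrArg Subtype.val h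
      exact absurd e.1.2 (h ▸ hdisj _ e'.1.2)
    · have h := congrArg Subtype.val h
      exact congrArg Sum.inr (Subtype.ext (Subtype.ext h))
  · rintro ⟨_, ⟨e, he, rfl⟩ | ⟨e, he, rfl⟩⟩
    · exact ⟨.inl ⟨e, he⟩, rfl⟩
    · exact ⟨.inr ⟨e, he⟩, rfl⟩
  · rintro (e | e) (v | v)
    · exact Iff.rfl
    · exact iff_of_false (fun h => v.2 (e.1.2 h)) id
    · exact iff_of_false (fun h => e.1.2 h v.2) id
    · exact Iff.rfl

theorem ofHyp_disjUnion_keep (S : Set (G.1.E ⊕ K.1.E)) :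
    ofHyp ((G.disjUnion K).keep S) =
      ofHyp (G.keep (Sum.inl ⁻¹' S)) * ofHyp (K.keep (Sum.inr ⁻¹' S)) := by
  rw [ofHyp_mul]
  symm
  refine ofHyp_eq_of_bijective (G := (G.keep (Sum.inl ⁻¹' S)).disjUnion (K.keep (Sum.inr ⁻¹' S)))
    (K := (G.disjUnion K).keep S) (p := id)
    (q := Sum.elim (fun e => ⟨.inl e.1, e.2⟩) fun e => ⟨.inr e.1, e.2⟩) bijective_id ⟨?_, ?_⟩ ?_
  · rintro (e | e) (e' | e') h
    · exact congrArg Sum.inl (Subtype.ext (Sum.inl_injective (congrArg Subtype.val h)))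
    · exact nomatch congrArg Subtype.val h
    · exact nomatch congrArg Subtype.val h
    · exact congrArg Sum.inr (Subtype.ext (Sum.inr_injective (congrArg Subtype.val h)))
  · rintro ⟨e | e, he⟩
    · exact ⟨.inl ⟨e, he⟩, rfl⟩
    · exact ⟨.inr ⟨e, he⟩, rfl⟩
  · rintro (e | e) (v | v) <;> exact Iff.rfl

theorem ofHyp_disjUnion_restrict (U : Set (G.1.V ⊕ K.1.V)) :
    ofHyp ((G.disjUnion K).restrict U) =
      ofHyp (G.restrict (Sum.inl ⁻¹' U)) * ofHyp (K.restrict (Sum.inr ⁻¹' U)) := by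
  rw [ofHyp_mul]
  symm
  refine ofHyp_eq_of_bijective
    (G := (G.restrict (Sum.inl ⁻¹' U)).disjUnion (K.restrict (Sum.inr ⁻¹' U)))
    (K := (G.disjUnion K).restrict U)
    (p := Sum.elim (fun v => ⟨.inl v.1, v.2⟩) fun v => ⟨.inr v.1, v.2⟩)
    (q := Sum.elim
      (fun e => ⟨.inl e.1, by
        rintro (v | v) hv
        · exact e.2 hv
        · exact hv.elim⟩)
      fun e => ⟨.inr e.1, by
        rintro (v | v) hv
        · exact hv.elim
        · exact e.2 hv⟩) ⟨?_, ?_⟩ ⟨?_, ?_⟩ ?_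
  · rintro (e | e) (e' | e') h
    · exact congrArg Sum.inl (Subtype.ext (Sum.inl_injective (congrArg Subtype.val h)))
    · exact nomatch congrArg Subtype.val h
    · exact nomatch congrArg Subtype.val h
    · exact congrArg Sum.inr (Subtype.ext (Sum.inr_injective (congrArg Subtype.val h)))
  · rintro ⟨v | v, hv⟩
    · exact ⟨.inl ⟨v, hv⟩, rfl⟩
    · exact ⟨.inr ⟨v, hv⟩, rfl⟩
  · rintro (e | e) (e' | e') h
    · exact congrArg Sum.inl (Subtype.ext (Sum.inl_injective (congrArg Subtype.val h)))
    · exact nomatch congrArg Subtype.val h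
    · exact nomatch congrArg Subtype.val h
    · exact congrArg Sum.inr (Subtype.ext (Sum.inr_injective (congrArg Subtype.val h)))
  · rintro ⟨e | e, he⟩
    · exact ⟨.inl ⟨e, fun v hv => he (show Sum.inl v ∈ _ from hv)⟩, rfl⟩
    · exact ⟨.inr ⟨e, fun v hv => he (show Sum.inr v ∈ _ from hv)⟩, rfl⟩
  · rintro (e | e) (v | v) <;> exact Iff.rfl

theorem ofHyp_disjUnion_contract (S : Set (G.1.E ⊕ K.1.E)) :
    ofHyp ((G.disjUnion K).contract S) =
      ofHyp (G.contract (Sum.inl ⁻¹' S)) * ofHyp (K.contract (Sum.inr ⁻¹' S)) := by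
  rw [ofHyp_mul]
  refine ofHyp_eq_of_presentation (G := (G.disjUnion K).contract S)
    (K := (G.contract (Sum.inl ⁻¹' S)).disjUnion (K.contract (Sum.inr ⁻¹' S)))
    (X := G.1.V ⊕ K.1.V)
    (Y := ((Sum.inl ⁻¹' S)ᶜ : Set G.1.E) ⊕ ((Sum.inr ⁻¹' S)ᶜ : Set K.1.E))
    (p := Quotient.mk _) (p' := Sum.map (Quotient.mk _) (Quotient.mk _))
    (q := Sum.elim (fun e => ⟨.inl e.1, e.2⟩) fun e => ⟨.inr e.1, e.2⟩)
    (q' := id)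
    (Sum.elim (fun e => (G.1.disjUnion K.1).edge (.inl e.1))
      fun e => (G.1.disjUnion K.1).edge (.inr e.1))
    Quotient.mk_surjective (Quotient.mk_surjective.sumMap Quotient.mk_surjective)
    ⟨?_, ?_⟩ bijective_id ?_ ?_ ?_
  · rintro (e | e) (e' | e') h
    · exact congrArg Sum.inl (Subtype.ext (Sum.inl_injective (congrArg Subtype.val h)))
    · exact nomatch congrArg Subtype.val h
    · exact nomatch congrArg Subtype.val h
    · exact congrArg Sum.inr (Subtype.ext (Sum.inr_injective (congrArg Subtype.val h)))
  · rintro ⟨e | e, he⟩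
    · exact ⟨.inl ⟨e, he⟩, rfl⟩
    · exact ⟨.inr ⟨e, he⟩, rfl⟩
  · intro x y
    refine Quotient.eq.trans ((contractSetoid_disjUnion S x y).trans ?_)
    rcases x with x | x <;> rcases y with y | y
    · refine Sum.liftRel_inl_inl.trans (Iff.trans ?_ Sum.inl_injective.eq_iff.symm)
      exact Quotient.eq.symm
    · exact iff_of_false (fun h => nomatch h) fun h => nomatch h
    · exact iff_of_false (fun h => nomatch h) fun h => nomatch h
    · refine Sum.liftRel_inr_inr.trans (Iff.trans ?_ Sum.inr_injective.eq_iff.symm)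
      exact Quotient.eq.symm
  · rintro (e | e) <;> exact rfl
  · rintro (e | e)
    · refine (disjUnion_edge_inl (G.1.contract _) (K.1.contract _) e).trans ?_
      change _ = Sum.map _ _ '' ((G.1.disjUnion K.1).edge (.inl e.1))
      rw [disjUnion_edge_inl, Set.image_image]
      exact Set.image_image _ _ _
    · refine (disjUnion_edge_inr (G.1.contract _) (K.1.contract _) e).trans ?_
      change _ = Sum.map _ _ '' ((G.1.disjUnion K.1).edge (.inr e.1))
      rw [disjUnion_edge_inr, Set.image_image]
      exact Set.image_image _ _ _

end HypAlg

/-! ### The double bialgebra axioms for H° -/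

namespace HypAlg

open FinHypergraph Function

variable (G K : EdgyHypergraph)

theorem ofHyp_restrict_univ : ofHyp (G.restrict Set.univ) = ofHyp G :=
  ofHyp_eq_of_bijective (G := G.restrict Set.univ) (K := G) (p := Subtype.val) (q := Subtype.val)
    ⟨Subtype.val_injective, fun v => ⟨⟨v, trivial⟩, rfl⟩⟩
    ⟨Subtype.val_injective, fun e => ⟨⟨e, Set.subset_univ _⟩, rfl⟩⟩ fun _ _ => Iff.rfl

theorem ofHyp_keep_univ : ofHyp (G.keep Set.univ) = ofHyp G :=
  ofHyp_eq_of_bijective (G := G.keep Set.univ) (K := G) (p := id) (q := Subtype.val)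
    bijective_id ⟨Subtype.val_injective, fun e => ⟨⟨e, trivial⟩, rfl⟩⟩ fun _ _ => Iff.rfl

theorem ofHyp_contract_empty : ofHyp (G.contract ∅) = ofHyp G := by
  refine ofHyp_eq_of_presentation (G := G.contract ∅) (K := G) (X := G.1.V)
    (Y := (∅ᶜ : Set G.1.E)) (p := Quotient.mk _) (p' := id) (q := id) (q' := Subtype.val)
    (fun e => G.1.edge e.1) Quotient.mk_surjective surjective_id bijective_id
    ⟨Subtype.val_injective, fun e => ⟨⟨e, id⟩, rfl⟩⟩ ?_ (fun _ => rfl) fun _ => by simp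
  intro x y
  refine Quotient.eq.trans ⟨fun h => ?_, fun h => ?_⟩
  · have : G.1.contractSetoid ∅ ≤ ⊥ := contractSetoid_le_iff.2 fun _ h => h.elim
    exact this h
  · obtain rfl : x = y := h
    exact Setoid.refl' _ _

theorem comulRes_coassoc :
    (TensorProduct.assoc ℚ HypAlg HypAlg HypAlg).toLinearMap ∘ₗ comulRes.rTensor HypAlg ∘ₗ
      comulRes = comulRes.lTensor HypAlg ∘ₗ comulRes := by
  refine linearMap_ext fun G => ?_
  have hl : ∀ U : Set G.1.V, TensorProduct.assoc ℚ HypAlg HypAlg HypAlg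
      (comulRes.rTensor HypAlg (ofHyp (G.restrict U) ⊗ₜ ofHyp (G.restrict Uᶜ))) =
      ∑ᶠ W : Set U, ofHyp (G.restrict (Subtype.val '' W)) ⊗ₜ[ℚ]
        (ofHyp (G.restrict (U \ Subtype.val '' W)) ⊗ₜ[ℚ] ofHyp (G.restrict Uᶜ)) := by
    intro U
    rw [LinearMap.rTensor_tmul, comulRes_ofHyp, resSum]
    refine ((congrArg (TensorProduct.assoc ℚ HypAlg HypAlg HypAlg) (map_finsum_of_finite
      ((TensorProduct.mk ℚ (HypAlg ⊗[ℚ] HypAlg) HypAlg).flip (ofHyp (G.restrict Uᶜ))) _)).trans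
      (map_finsum_of_finite _ _)).trans (finsum_congr fun W => ?_)
    exact congrArg₂ (fun a b => a ⊗ₜ[ℚ] (b ⊗ₜ[ℚ] _)) (ofHyp_restrict_restrict G U W)
      ((ofHyp_restrict_restrict G U (Wᶜ : Set U)).trans
        (congrArg (fun S => ofHyp (G.restrict S)) Set.image_val_compl))
  have hr : ∀ U : Set G.1.V,
      comulRes.lTensor HypAlg (ofHyp (G.restrict U) ⊗ₜ ofHyp (G.restrict Uᶜ)) =
      ∑ᶠ W : Set ↥Uᶜ, ofHyp (G.restrict U) ⊗ₜ[ℚ] (ofHyp (G.restrict (Subtype.val '' W)) ⊗ₜ[ℚ]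
        ofHyp (G.restrict (Uᶜ \ Subtype.val '' W))) := by
    intro U
    rw [LinearMap.lTensor_tmul, comulRes_ofHyp, resSum]
    refine (map_finsum_of_finite
      (TensorProduct.mk ℚ HypAlg (HypAlg ⊗[ℚ] HypAlg) (ofHyp (G.restrict U))) _).trans
        (finsum_congr fun W => ?_)
    exact congrArg₂ (fun a b => _ ⊗ₜ[ℚ] (a ⊗ₜ[ℚ] b)) (ofHyp_restrict_restrict G Uᶜ W)
      ((ofHyp_restrict_restrict G Uᶜ (Wᶜ : Set ↥Uᶜ)).trans
        (congrArg (fun S => ofHyp (G.restrict S)) Set.image_val_compl))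
  simp only [LinearMap.comp_apply, LinearEquiv.coe_coe, comulRes_ofHyp, resSum,
    map_finsum_of_finite, hl, hr]
  rw [finsum_finsum_set (fun U => U) fun U W => ofHyp (G.restrict W) ⊗ₜ[ℚ]
      (ofHyp (G.restrict (U \ W)) ⊗ₜ[ℚ] ofHyp (G.restrict Uᶜ)),
    finsum_finsum_set (fun U => Uᶜ) fun U W => ofHyp (G.restrict U) ⊗ₜ[ℚ]
      (ofHyp (G.restrict W) ⊗ₜ[ℚ] ofHyp (G.restrict (Uᶜ \ W)))]
  -- A partition of V into blocks A, B, C is indexed on the left by (A ∪ B, A) and on the right by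
  -- (A, B).
  refine finsum_eq_of_bijective
    (fun p => ⟨(p.1.2, p.1.1 \ p.1.2), fun v hv => hv.2⟩) ⟨?_, ?_⟩ ?_
  · rintro ⟨⟨U, W⟩, h : W ⊆ U⟩ ⟨⟨U', W'⟩, h' : W' ⊆ U'⟩ heq
    obtain rfl : W = W' := congrArg (fun p => p.1.1) heq
    have heq : U \ W = U' \ W := congrArg (fun p => p.1.2) heq
    refine Subtype.ext (Prod.ext ?_ rfl)
    change U = U'
    rw [← Set.union_sdiff_cancel h, heq, Set.union_sdiff_cancel h']
  · rintro ⟨⟨U, W⟩, h : W ⊆ Uᶜ⟩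
    refine ⟨⟨(U ∪ W, U), Set.subset_union_left⟩, Subtype.ext (Prod.ext rfl ?_)⟩
    exact Set.union_sdiff_cancel_left fun v hv => h hv.2 hv.1
  · rintro ⟨⟨U, W⟩, h : W ⊆ U⟩
    have : Wᶜ \ (U \ W) = Uᶜ := by
      ext v
      have := @h v
      simp only [Set.mem_sdiff, Set.mem_compl_iff]
      tauto
    simp only [this]

theorem comulExt_coassoc :
    (TensorProduct.assoc ℚ HypAlg HypAlg HypAlg).toLinearMap ∘ₗ comulExt.rTensor HypAlg ∘ₗ
      comulExt = comulExt.lTensor HypAlg ∘ₗ comulExt := by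
  refine linearMap_ext fun G => ?_
  have hl : ∀ F : Set G.1.E, TensorProduct.assoc ℚ HypAlg HypAlg HypAlg
      (comulExt.rTensor HypAlg (ofHyp (G.keep F) ⊗ₜ ofHyp (G.contract F))) =
      ∑ᶠ F' : Set F, ofHyp (G.keep (Subtype.val '' F')) ⊗ₜ[ℚ]
        (ofHyp ((G.contract (Subtype.val '' F')).keep {e | e.1 ∈ F}) ⊗ₜ[ℚ]
          ofHyp (G.contract F)) := by
    intro F
    rw [LinearMap.rTensor_tmul, comulExt_ofHyp, extSum]
    refine ((congrArg (TensorProduct.assoc ℚ HypAlg HypAlg HypAlg) (map_finsum_of_finite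
      ((TensorProduct.mk ℚ (HypAlg ⊗[ℚ] HypAlg) HypAlg).flip (ofHyp (G.contract F))) _)).trans
      (map_finsum_of_finite _ _)).trans (finsum_congr fun F' => ?_)
    exact congrArg₂ (fun a b => a ⊗ₜ[ℚ] (b ⊗ₜ[ℚ] _)) (ofHyp_keep_keep G F F')
      (ofHyp_keep_contract G F F')
  have hr : ∀ F : Set G.1.E,
      comulExt.lTensor HypAlg (ofHyp (G.keep F) ⊗ₜ ofHyp (G.contract F)) =
      ∑ᶠ S : Set ↥Fᶜ, ofHyp (G.keep F) ⊗ₜ[ℚ]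
        (ofHyp ((G.contract F).keep {e | e.1 ∈ Subtype.val '' S}) ⊗ₜ[ℚ]
        ofHyp (G.contract (F ∪ Subtype.val '' S))) := by
    intro F
    rw [LinearMap.lTensor_tmul, comulExt_ofHyp, extSum]
    refine (map_finsum_of_finite
      (TensorProduct.mk ℚ HypAlg (HypAlg ⊗[ℚ] HypAlg) (ofHyp (G.keep F))) _).trans
        (finsum_congr fun S => ?_)
    refine congrArg₂ (fun a b => _ ⊗ₜ[ℚ] (a ⊗ₜ[ℚ] b)) ?_ (ofHyp_contract_contract G F S)
    exact congrArg (fun T => ofHyp ((G.contract F).keep T))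
      (Set.preimage_image_eq S Subtype.val_injective).symm
  simp only [LinearMap.comp_apply, LinearEquiv.coe_coe, comulExt_ofHyp, extSum,
    map_finsum_of_finite, hl, hr]
  rw [finsum_finsum_set (fun F => F) fun F F' => ofHyp (G.keep F') ⊗ₜ[ℚ]
        (ofHyp ((G.contract F').keep {e | e.1 ∈ F}) ⊗ₜ[ℚ] ofHyp (G.contract F)),
    finsum_finsum_set (fun F => Fᶜ) fun F S => ofHyp (G.keep F) ⊗ₜ[ℚ]
        (ofHyp ((G.contract F).keep {e | e.1 ∈ S}) ⊗ₜ[ℚ] ofHyp (G.contract (F ∪ S)))]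
  symm
  -- After the symmetry the map goes from disjoint pairs (F, S) to chains F ⊆ F ∪ S; its inverse
  -- sends a chain W ⊆ U to (W, U \ W).
  refine finsum_eq_of_bijective
    (fun p => ⟨(p.1.1 ∪ p.1.2, p.1.1), Set.subset_union_left⟩) ⟨?_, ?_⟩ ?_
  · rintro ⟨⟨U, W⟩, h : W ⊆ Uᶜ⟩ ⟨⟨U', W'⟩, h' : W' ⊆ U'ᶜ⟩ heq
    simp only [Subtype.mk.injEq, Prod.mk.injEq] at heq ⊢
    obtain ⟨heq, rfl⟩ := heq
    refine ⟨rfl, ?_⟩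
    rw [← Set.union_sdiff_cancel_left (s := U) (t := W) fun v hv => h hv.2 hv.1, heq,
      Set.union_sdiff_cancel_left fun v hv => h' hv.2 hv.1]
  · rintro ⟨⟨U, W⟩, h : W ⊆ U⟩
    refine ⟨⟨(W, U \ W), fun v hv => hv.2⟩, Subtype.ext (Prod.ext ?_ rfl)⟩
    exact Set.union_sdiff_cancel h
  · rintro ⟨⟨F, S⟩, h : S ⊆ Fᶜ⟩
    have : {e : (Fᶜ : Set G.1.E) | e.1 ∈ S} = {e | e.1 ∈ F ∪ S} :=
      Set.ext fun e => ⟨.inr, fun h => h.resolve_left e.2⟩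
    exact congrArg (fun T => _ ⊗ₜ[ℚ] (ofHyp ((G.contract F).keep T) ⊗ₜ[ℚ] _)) this

theorem resSum_disjUnion : resSum (G.disjUnion K) = resSum G * resSum K := by
  unfold resSum
  rw [finsum_mul_finsum_of_finite]
  refine finsum_eq_of_bijective
    (fun U : Set (G.1.V ⊕ K.1.V) => (Sum.inl ⁻¹' U, Sum.inr ⁻¹' U)) ⟨?_, ?_⟩ ?_
  · intro U U' h
    simp only [Prod.mk.injEq] at h
    ext (v | v)
    · exact Set.ext_iff.1 h.1 v
    · exact Set.ext_iff.1 h.2 v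
  · rintro ⟨U, U'⟩
    exact ⟨Sum.elim U U', rfl⟩
  · intro U
    exact (congrArg₂ (· ⊗ₜ[ℚ] ·) (ofHyp_disjUnion_restrict G K U)
      (ofHyp_disjUnion_restrict G K (Uᶜ : Set (G.1.V ⊕ K.1.V)))).trans
        (Algebra.TensorProduct.tmul_mul_tmul _ _ _ _).symm

theorem extSum_disjUnion : extSum (G.disjUnion K) = extSum G * extSum K := by
  unfold extSum
  rw [finsum_mul_finsum_of_finite]
  refine finsum_eq_of_bijective
    (fun U : Set (G.1.E ⊕ K.1.E) => (Sum.inl ⁻¹' U, Sum.inr ⁻¹' U)) ⟨?_, ?_⟩ ?_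
  · intro U U' h
    simp only [Prod.mk.injEq] at h
    ext (v | v)
    · exact Set.ext_iff.1 h.1 v
    · exact Set.ext_iff.1 h.2 v
  · rintro ⟨U, U'⟩
    exact ⟨Sum.elim U U', rfl⟩
  · intro U
    rw [ofHyp_disjUnion_keep G K U, ofHyp_disjUnion_contract G K U,
      Algebra.TensorProduct.tmul_mul_tmul]

instance : IsEmpty EdgyHypergraph.empty.1.V := inferInstanceAs (IsEmpty Empty)

instance : IsEmpty EdgyHypergraph.empty.1.E := inferInstanceAs (IsEmpty Empty)

theorem ofHyp_eq_one [IsEmpty G.1.V] [IsEmpty G.1.E] : ofHyp G = 1 := by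
  rw [← ofHyp_empty]
  exact ofHyp_eq ⟨Equiv.equivOfIsEmpty _ _, Equiv.equivOfIsEmpty _ _, fun e => isEmptyElim e⟩

theorem isEmpty_edges [IsEmpty G.1.V] : IsEmpty G.1.E :=
  ⟨fun e => isEmptyElim (G.2 e).some⟩

theorem comulRes_isBialgebra : IsBialgebra comulRes counitRes where
  coassoc := comulRes_coassoc
  counit_left := by
    refine linearMap_ext fun G => ?_
    simp only [LinearMap.comp_apply, LinearEquiv.coe_coe, comulRes_ofHyp, resSum,
      map_finsum_of_finite, LinearMap.rTensor_tmul, TensorProduct.lid_tmul, counitRes_ofHyp]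
    -- The counit kills every term except the one with U empty.
    rw [finsum_eq_single _ ∅ fun U hU => ?_, Set.compl_empty, ofHyp_restrict_univ, if_pos]
    · simp
    · exact inferInstanceAs (IsEmpty (∅ : Set G.1.V))
    · rw [if_neg, zero_smul]
      exact fun h => hU (Set.isEmpty_coe_sort.1 h)
  counit_right := by
    refine linearMap_ext fun G => ?_
    simp only [LinearMap.comp_apply, LinearEquiv.coe_coe, comulRes_ofHyp, resSum,
      map_finsum_of_finite, LinearMap.lTensor_tmul, TensorProduct.rid_tmul, counitRes_ofHyp]
    rw [finsum_eq_single _ Set.univ fun U hU => ?_, Set.compl_univ, ofHyp_restrict_univ, if_pos]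
    · simp
    · exact inferInstanceAs (IsEmpty (∅ : Set G.1.V))
    · rw [if_neg, zero_smul]
      exact fun h => hU (Set.compl_empty_iff.1 (Set.isEmpty_coe_sort.1 h))
  comul_one := by
    rw [← ofHyp_empty, comulRes_ofHyp, resSum]
    have : Unique (Set EdgyHypergraph.empty.1.V) := Set.uniqueEmpty
    rw [finsum_unique]
    have h : ∀ U, ofHyp (EdgyHypergraph.empty.restrict U) = 1 := fun U => by
      have : IsEmpty (EdgyHypergraph.empty.restrict U).1.V :=
        inferInstanceAs (IsEmpty (U : Set Empty))
      have := isEmpty_edges (EdgyHypergraph.empty.restrict U)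
      exact ofHyp_eq_one _
    rw [h, h]
    rfl
  comul_mul := map_mul_of_ofHyp _ fun G K => by
    simp only [comulRes_ofHyp, resSum_disjUnion]
  counit_one := by
    rw [← ofHyp_empty, counitRes_ofHyp]
    exact if_pos (inferInstance : IsEmpty EdgyHypergraph.empty.1.V)
  counit_mul := map_mul_of_ofHyp _ fun G K => by
    have : IsEmpty (G.disjUnion K).1.V ↔ IsEmpty G.1.V ∧ IsEmpty K.1.V := isEmpty_sum
    simp only [counitRes_ofHyp, this]
    split_ifs <;> simp_all

theorem comulExt_isBialgebra : IsBialgebra comulExt counitExt where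
  coassoc := comulExt_coassoc
  counit_left := by
    refine linearMap_ext fun G => ?_
    simp only [LinearMap.comp_apply, LinearEquiv.coe_coe, comulExt_ofHyp, extSum,
      map_finsum_of_finite, LinearMap.rTensor_tmul, TensorProduct.lid_tmul, counitExt_ofHyp]
    rw [finsum_eq_single _ ∅ fun U hU => ?_, ofHyp_contract_empty, if_pos]
    · simp
    · exact inferInstanceAs (IsEmpty (∅ : Set G.1.E))
    · rw [if_neg, zero_smul]
      exact fun h => hU (Set.isEmpty_coe_sort.1 h)
  counit_right := by
    refine linearMap_ext fun G => ?_
    simp only [LinearMap.comp_apply, LinearEquiv.coe_coe, comulExt_ofHyp, extSum,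
      map_finsum_of_finite, LinearMap.lTensor_tmul, TensorProduct.rid_tmul, counitExt_ofHyp]
    rw [finsum_eq_single _ Set.univ fun U hU => ?_, ofHyp_keep_univ, if_pos]
    · simp
    · refine Set.isEmpty_coe_sort.2 (Set.compl_univ (α := G.1.E))
    · rw [if_neg, zero_smul]
      exact fun h => hU (Set.compl_empty_iff.1 (Set.isEmpty_coe_sort.1 h))
  comul_one := by
    rw [← ofHyp_empty, comulExt_ofHyp, extSum]
    have : Unique (Set EdgyHypergraph.empty.1.E) := Set.uniqueEmpty
    rw [finsum_unique]
    have h : ∀ F, ofHyp (EdgyHypergraph.empty.keep F) = 1 := fun F => by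
      have : IsEmpty (EdgyHypergraph.empty.keep F).1.V := inferInstanceAs (IsEmpty Empty)
      have := isEmpty_edges (EdgyHypergraph.empty.keep F)
      exact ofHyp_eq_one _
    have h' : ∀ F, ofHyp (EdgyHypergraph.empty.contract F) = 1 := fun F => by
      have : IsEmpty (EdgyHypergraph.empty.contract F).1.V :=
        inferInstanceAs (IsEmpty (Quotient (EdgyHypergraph.empty.1.contractSetoid F)))
      have := isEmpty_edges (EdgyHypergraph.empty.contract F)
      exact ofHyp_eq_one _
    rw [h, h']
    rfl
  comul_mul := map_mul_of_ofHyp _ fun G K => by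
    simp only [comulExt_ofHyp, extSum_disjUnion]
  counit_one := by
    rw [← ofHyp_empty, counitExt_ofHyp]
    exact if_pos (inferInstance : IsEmpty EdgyHypergraph.empty.1.E)
  counit_mul := map_mul_of_ofHyp _ fun G K => by
    have : IsEmpty (G.disjUnion K).1.E ↔ IsEmpty G.1.E ∧ IsEmpty K.1.E := isEmpty_sum
    simp only [counitExt_ofHyp, this]
    split_ifs <;> simp_all

/-- V/F is empty exactly when V is, so the counit takes the same value in all terms. If V is empty
there are no edges, and the single term is the unit. -/
theorem counitRes_comodule : (TensorProduct.rid ℚ HypAlg).toLinearMap ∘ₗ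
    counitRes.lTensor HypAlg ∘ₗ comulExt = Algebra.linearMap ℚ HypAlg ∘ₗ counitRes := by
  classical
  refine linearMap_ext fun G => ?_
  have hV : ∀ F, IsEmpty (G.contract F).1.V ↔ IsEmpty G.1.V := fun F => by
    simp only [← not_nonempty_iff]
    exact not_congr (nonempty_quotient_iff (G.1.contractSetoid F))
  have hε : ∀ F, counitRes (ofHyp (G.contract F)) = counitRes (ofHyp G) := fun F => by
    rw [counitRes_ofHyp, counitRes_ofHyp]
    exact if_congr (hV F) rfl rfl
  simp only [LinearMap.comp_apply, LinearEquiv.coe_coe, comulExt_ofHyp, extSum,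
    map_finsum_of_finite, LinearMap.lTensor_tmul, TensorProduct.rid_tmul, hε]
  rw [counitRes_ofHyp]
  split_ifs with h
  · have := isEmpty_edges G
    have : Unique (Set G.1.E) := Set.uniqueEmpty
    rw [finsum_unique, one_smul, Algebra.linearMap_apply, map_one]
    exact @ofHyp_eq_one (G.keep _) h (@isEmpty_edges (G.keep _) h)
  · simp

theorem comulRes_comodule : comulRes.lTensor HypAlg ∘ₗ comulExt =
    mulOneThree HypAlg ∘ₗ TensorProduct.map comulExt comulExt ∘ₗ comulRes := by
  refine linearMap_ext fun G => ?_
  -- The common summand of the two sides, to be summed over the pairs (U, F) with F saturating U.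
  let T : Set G.1.V → Set G.1.E → HypAlg ⊗[ℚ] (HypAlg ⊗[ℚ] HypAlg) := fun U F =>
    ofHyp (G.keep F) ⊗ₜ (ofHyp ((G.restrict U).contract {e | e.1 ∈ F}) ⊗ₜ
      ofHyp ((G.restrict Uᶜ).contract {e | e.1 ∈ F}))
  have hl : ∀ F : Set G.1.E,
      comulRes.lTensor HypAlg (ofHyp (G.keep F) ⊗ₜ ofHyp (G.contract F)) =
      ∑ᶠ U : Set (Quotient (G.1.contractSetoid F)), T (Quotient.mk _ ⁻¹' U) F := by
    intro F
    rw [LinearMap.lTensor_tmul, comulRes_ofHyp, resSum]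
    refine (map_finsum_of_finite
      (TensorProduct.mk ℚ HypAlg (HypAlg ⊗[ℚ] HypAlg) (ofHyp (G.keep F))) _).trans
        (finsum_congr fun U => ?_)
    exact congrArg₂ (fun a b => _ ⊗ₜ[ℚ] (a ⊗ₜ[ℚ] b)) (ofHyp_contract_restrict G F U)
      (ofHyp_contract_restrict G F Uᶜ)
  -- Edges being non-empty, F and F' can be recovered from their union in E. This gives the
  -- contractions below and the injectivity of the second reindexing.
  have hcontr : ∀ (U : Set G.1.V) (F : Set (G.1.restrict U).E) (F' : Set (G.1.restrict Uᶜ).E),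
      {e : (G.1.restrict U).E | e.1 ∈ Subtype.val '' F ∪ Subtype.val '' F'} = F ∧
      {e : (G.1.restrict Uᶜ).E | e.1 ∈ Subtype.val '' F ∪ Subtype.val '' F'} = F' := by
    have hdisj : ∀ (U : Set G.1.V) (e : G.1.E), G.1.edge e ⊆ U → ¬ G.1.edge e ⊆ Uᶜ :=
      fun U e h h' => by
        obtain ⟨v, hv⟩ := G.2 e
        exact h' hv (h hv)
    intro U F F'
    constructor
    · ext e
      refine ⟨?_, fun he => .inl ⟨e, he, rfl⟩⟩
      rintro (⟨e', he', h⟩ | ⟨e', he', h⟩)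
      · exact Subtype.ext h ▸ he'
      · exact absurd e'.2 (h ▸ hdisj U e.1 e.2)
    · ext e
      refine ⟨?_, fun he => .inr ⟨e, he, rfl⟩⟩
      rintro (⟨e', he', h⟩ | ⟨e', he', h⟩)
      · exact absurd e.2 (h ▸ hdisj U e'.1 e'.2)
      · exact Subtype.ext h ▸ he'
  have hr : ∀ U : Set G.1.V, mulOneThree HypAlg (TensorProduct.map comulExt comulExt
      (ofHyp (G.restrict U) ⊗ₜ ofHyp (G.restrict Uᶜ))) =
      ∑ᶠ p : Set (G.1.restrict U).E × Set (G.1.restrict Uᶜ).E,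
        T U (Subtype.val '' p.1 ∪ Subtype.val '' p.2) := by
    intro U
    rw [TensorProduct.map_tmul, comulExt_ofHyp, comulExt_ofHyp, extSum, extSum,
      finsum_tmul_finsum_of_finite, map_finsum_of_finite]
    refine finsum_congr fun ⟨F, F'⟩ => ?_
    refine Eq.trans (b := (ofHyp ((G.restrict U).keep F) * ofHyp ((G.restrict Uᶜ).keep F')) ⊗ₜ
      (ofHyp ((G.restrict U).contract F) ⊗ₜ ofHyp ((G.restrict Uᶜ).contract F'))) (by
        simp [mulOneThree]) ?_
    refine (congrArg (· ⊗ₜ[ℚ] _) (ofHyp_restrict_keep_mul G U F F')).trans ?_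
    exact congrArg₂ (fun S S' => _ ⊗ₜ[ℚ] (ofHyp ((G.restrict U).contract S) ⊗ₜ[ℚ]
      ofHyp ((G.restrict Uᶜ).contract S'))) (hcontr U F F').1.symm (hcontr U F F').2.symm
  simp only [LinearMap.comp_apply, comulRes_ofHyp, resSum, comulExt_ofHyp, extSum,
    map_finsum_of_finite, hl, hr]
  rw [finsum_finsum_sigma_of_finite (β := fun F => Set (Quotient (G.1.contractSetoid F)))
      fun F U => T (Quotient.mk _ ⁻¹' U) F,
    finsum_finsum_sigma_of_finite
      (β := fun U => Set (G.1.restrict U).E × Set (G.1.restrict Uᶜ).E)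
      fun U p => T U (Subtype.val '' p.1 ∪ Subtype.val '' p.2)]
  trans ∑ᶠ p : {p : Set G.1.V × Set G.1.E // G.1.Saturated p.1 p.2}, T p.1.1 p.1.2
  · refine finsum_eq_of_bijective
      (fun p => ⟨(Quotient.mk _ ⁻¹' p.2, p.1), saturated_preimage p.1 p.2⟩) ⟨?_, ?_⟩ fun _ => rfl
    · rintro ⟨F, U⟩ ⟨F', U'⟩ h
      simp only [Subtype.mk.injEq, Prod.mk.injEq] at h
      obtain ⟨h, rfl⟩ := h
      rw [Quotient.mk_surjective.preimage_injective h]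
    · rintro ⟨⟨U, F⟩, h⟩
      exact ⟨⟨F, Quotient.mk _ '' U⟩, Subtype.ext (Prod.ext h.preimage_image rfl)⟩
  · symm
    refine finsum_eq_of_bijective
      (fun p => ⟨(p.1, Subtype.val '' p.2.1 ∪ Subtype.val '' p.2.2), ?_⟩) ⟨?_, ?_⟩ fun _ => rfl
    · rintro _ (⟨e, _, rfl⟩ | ⟨e, _, rfl⟩)
      · exact .inl e.2
      · exact .inr e.2
    · rintro ⟨U, F, F'⟩ ⟨U₁, F₁, F₁'⟩ h
      obtain rfl : U = U₁ := congrArg (fun p => p.1.1) h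
      replace h : Subtype.val '' F ∪ Subtype.val '' F' = Subtype.val '' F₁ ∪ Subtype.val '' F₁' :=
        congrArg (fun p => p.1.2) h
      have h₁ := hcontr U F F'
      rw [h, (hcontr U F₁ F₁').1, (hcontr U F₁ F₁').2] at h₁
      rw [h₁.1, h₁.2]
    · rintro ⟨⟨U, F⟩, h⟩
      refine ⟨⟨U, {e | e.1 ∈ F}, {e | e.1 ∈ F}⟩, Subtype.ext (Prod.ext rfl (Set.ext fun e => ?_))⟩
      constructor
      · rintro (⟨e, he, rfl⟩ | ⟨e, he, rfl⟩) <;> exact he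
      · exact fun he => (h e he).imp (fun h => ⟨⟨e, h⟩, he, rfl⟩) fun h => ⟨⟨e, h⟩, he, rfl⟩

end HypAlg

theorem hypDouble_isDoubleBialgebra : hypDouble.IsDoubleBialgebra where
  bialgebra_Δ := HypAlg.comulRes_isBialgebra
  bialgebra_δ := HypAlg.comulExt_isBialgebra
  counit_comodule := HypAlg.counitRes_comodule
  comul_comodule := HypAlg.comulRes_comodule

/-! ### The double bialgebra ℚ[x] and evaluation of its tensor square -/

section PolynomialDoubleBialgebra

open Polynomial

/-- Stated with algebra morphisms, the axioms for ℚ[x] need only be compared at the generator X. -/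
theorem isBialgebra_of_algHom {B : Type*} [CommRing B] [Algebra ℚ B] (Δ : B →ₐ[ℚ] B ⊗[ℚ] B)
    (ε : B →ₐ[ℚ] ℚ)
    (coassoc : (Algebra.TensorProduct.assoc ℚ ℚ ℚ B B B).toAlgHom.comp
      ((Algebra.TensorProduct.map Δ (AlgHom.id ℚ B)).comp Δ) =
        (Algebra.TensorProduct.map (AlgHom.id ℚ B) Δ).comp Δ)
    (counit_left : (Algebra.TensorProduct.lid ℚ B).toAlgHom.comp
      ((Algebra.TensorProduct.map ε (AlgHom.id ℚ B)).comp Δ) = AlgHom.id ℚ B)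
    (counit_right : (Algebra.TensorProduct.rid ℚ ℚ B).toAlgHom.comp
      ((Algebra.TensorProduct.map (AlgHom.id ℚ B) ε).comp Δ) = AlgHom.id ℚ B) :
    IsBialgebra Δ.toLinearMap ε.toLinearMap where
  coassoc := LinearMap.ext fun b => AlgHom.congr_fun coassoc b
  counit_left := LinearMap.ext fun b => AlgHom.congr_fun counit_left b
  counit_right := LinearMap.ext fun b => AlgHom.congr_fun counit_right b
  comul_one := map_one Δ
  comul_mul := map_mul Δ
  counit_one := map_one ε
  counit_mul := map_mul ε

/-- The map `mulOneThree` as a morphism of algebras. -/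
def mulOneThreeAlgHom (B : Type*) [CommRing B] [Algebra ℚ B] :
    (B ⊗[ℚ] B) ⊗[ℚ] (B ⊗[ℚ] B) →ₐ[ℚ] B ⊗[ℚ] (B ⊗[ℚ] B) :=
  (Algebra.TensorProduct.map (Algebra.TensorProduct.lmul' ℚ (S := B)) (AlgHom.id ℚ _)).comp
    (Algebra.TensorProduct.tensorTensorTensorComm ℚ ℚ ℚ ℚ B B B B).toAlgHom

theorem mulOneThreeAlgHom_toLinearMap (B : Type*) [CommRing B] [Algebra ℚ B] :
    (mulOneThreeAlgHom B).toLinearMap = mulOneThree B := by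
  refine TensorProduct.ext_fourfold' fun a b c d => ?_
  simp [mulOneThreeAlgHom, mulOneThree]

theorem polyDouble_isDoubleBialgebra : polyDouble.IsDoubleBialgebra where
  bialgebra_Δ := by
    refine isBialgebra_of_algHom _ _ (algHom_ext ?_) (algHom_ext ?_) (algHom_ext ?_)
    · simp [TensorProduct.add_tmul, TensorProduct.tmul_add, Algebra.TensorProduct.one_def,
        add_assoc]
    · simp
    · simp
  bialgebra_δ := by
    refine isBialgebra_of_algHom _ _ (algHom_ext ?_) (algHom_ext ?_) (algHom_ext ?_)
    · simp
    · simp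
    · simp
  counit_comodule := by
    have : (Algebra.TensorProduct.rid ℚ ℚ ℚ[X]).toAlgHom.comp
        ((Algebra.TensorProduct.map (AlgHom.id ℚ ℚ[X]) (aeval (0 : ℚ))).comp
          (aeval (X ⊗ₜ[ℚ] X : ℚ[X] ⊗[ℚ] ℚ[X]))) =
        (Algebra.ofId ℚ ℚ[X]).comp (aeval (0 : ℚ)) := algHom_ext (by simp)
    exact LinearMap.ext fun p => AlgHom.congr_fun this p
  comul_comodule := by
    have : (Algebra.TensorProduct.map (AlgHom.id ℚ ℚ[X])
          (aeval (X ⊗ₜ[ℚ] 1 + 1 ⊗ₜ[ℚ] X : ℚ[X] ⊗[ℚ] ℚ[X]))).comp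
          (aeval (X ⊗ₜ[ℚ] X : ℚ[X] ⊗[ℚ] ℚ[X])) =
        (mulOneThreeAlgHom ℚ[X]).comp
          ((Algebra.TensorProduct.map (aeval (X ⊗ₜ[ℚ] X : ℚ[X] ⊗[ℚ] ℚ[X]))
            (aeval (X ⊗ₜ[ℚ] X : ℚ[X] ⊗[ℚ] ℚ[X]))).comp
              (aeval (X ⊗ₜ[ℚ] 1 + 1 ⊗ₜ[ℚ] X : ℚ[X] ⊗[ℚ] ℚ[X]))) :=
      algHom_ext (by
        simp [mulOneThreeAlgHom, TensorProduct.tmul_add, Algebra.TensorProduct.one_def])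
    rw [← mulOneThreeAlgHom_toLinearMap]
    exact LinearMap.ext fun p => AlgHom.congr_fun this p

theorem Polynomial.ext_of_eval_natCast {p q : ℚ[X]} (h : ∀ n : ℕ, p.eval (n : ℚ) = q.eval (n : ℚ)) :
    p = q :=
  eq_of_infinite_eval_eq p q (Set.infinite_of_injective_forall_mem Nat.cast_injective h)

/-- Evaluation of the two tensor factors at two natural numbers. -/
def evalTensor (m n : ℕ) : ℚ[X] ⊗[ℚ] ℚ[X] →ₐ[ℚ] ℚ :=
  Algebra.TensorProduct.productMap (aeval (m : ℚ)) (aeval (n : ℚ))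

theorem evalTensor_tmul (m n : ℕ) (p q : ℚ[X]) :
    evalTensor m n (p ⊗ₜ q) = p.eval (m : ℚ) * q.eval (n : ℚ) := by
  simp [evalTensor, coe_aeval_eq_eval]

theorem evalTensor_comul_add (m n : ℕ) (p : ℚ[X]) :
    evalTensor m n (polyDouble.Δ p) = p.eval ((m + n : ℕ) : ℚ) := by
  have : (evalTensor m n).comp (aeval (X ⊗ₜ[ℚ] 1 + 1 ⊗ₜ[ℚ] X : ℚ[X] ⊗[ℚ] ℚ[X])) =
      aeval ((m + n : ℕ) : ℚ) := algHom_ext (by simp [evalTensor_tmul])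
  exact (AlgHom.congr_fun this p).trans (congrFun (coe_aeval_eq_eval _) p)

theorem evalTensor_comul_mul (m n : ℕ) (p : ℚ[X]) :
    evalTensor m n (polyDouble.δ p) = p.eval ((m * n : ℕ) : ℚ) := by
  have : (evalTensor m n).comp (aeval (X ⊗ₜ[ℚ] X : ℚ[X] ⊗[ℚ] ℚ[X])) =
      aeval ((m * n : ℕ) : ℚ) := algHom_ext (by simp [evalTensor_tmul])
  exact (AlgHom.congr_fun this p).trans (congrFun (coe_aeval_eq_eval _) p)

/-- Write the difference as a sum of X ^ i ⊗ c i. For fixed n it becomes a polynomial in the first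
variable that vanishes at every m, so each c i vanishes at every n. -/
theorem tensor_ext_of_evalTensor {s t : ℚ[X] ⊗[ℚ] ℚ[X]}
    (h : ∀ m n, evalTensor m n s = evalTensor m n t) : s = t := by
  rw [← sub_eq_zero]
  obtain ⟨c, hc⟩ := TensorProduct.eq_repr_basis_left (basisMonomials ℚ) (s - t)
  have hzero : ∀ n : ℕ, c.sum (fun i q => monomial i (q.eval (n : ℚ))) = 0 := by
    refine fun n => ext_of_eval_natCast fun m => ?_
    have := sub_eq_zero.2 (h m n)
    rw [← map_sub, ← hc, Finsupp.sum, map_sum] at this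
    rw [Finsupp.sum, eval_finsetSum, eval_zero, ← this]
    refine Finset.sum_congr rfl fun i _ => ?_
    simp [evalTensor_tmul, mul_comm]
  have hc0 : c = 0 := by
    ext1 i
    refine ext_of_eval_natCast fun n => ?_
    have := congrArg (fun p => coeff p i) (hzero n)
    simp only [Finsupp.sum, finsetSum_coeff, coeff_monomial, coeff_zero,
      Finset.sum_ite_eq', Finsupp.mem_support_iff] at this
    by_cases hi : c i = 0
    · simp [hi]
    · simpa [hi] using this
  rw [← hc, hc0, Finsupp.sum_zero_index]

end PolynomialDoubleBialgebra

/-! ### Counting colourings -/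

namespace FinHypergraph

open Function

variable (G K : FinHypergraph) (C D : Type)

instance [Finite C] : Finite (G.Coloring C) :=
  inferInstanceAs (Finite {c : G.V → C // ∀ e, ¬ ∀ u ∈ G.edge e, ∀ v ∈ G.edge e, c u = c v})

variable {G K C D}

theorem Coloring.ext {c d : G.Coloring C} (h : ∀ v, c.1 v = d.1 v) : c = d :=
  Subtype.ext (funext h)

theorem card_coloring_congr (f : Iso G K) (C : Type) :
    Nat.card (G.Coloring C) = Nat.card (K.Coloring C) := by
  refine Nat.card_congr (Equiv.subtypeEquiv (f.onV.arrowCongr (Equiv.refl C)) fun c => ?_)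
  refine f.onE.forall_congr fun e => not_congr ?_
  refine f.onV.forall_congr fun u => imp_congr (f.mem_iff e u).symm ?_
  exact f.onV.forall_congr fun v => imp_congr (f.mem_iff e v).symm (by simp)

theorem card_coloring_congr_right (f : C ≃ D) (G : FinHypergraph) :
    Nat.card (G.Coloring C) = Nat.card (G.Coloring D) :=
  Nat.card_congr (Equiv.subtypeEquiv ((Equiv.refl G.V).arrowCongr f) fun c => by simp)

theorem card_coloring_of_isEmpty [IsEmpty G.V] [IsEmpty G.E] : Nat.card (G.Coloring C) = 1 := by
  have : Unique (G.Coloring C) :=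
    { default := ⟨isEmptyElim, isEmptyElim⟩
      uniq := fun c => Coloring.ext isEmptyElim }
  exact Nat.card_unique

theorem card_coloring_disjUnion (G K : FinHypergraph) (C : Type) :
    Nat.card ((G.disjUnion K).Coloring C) =
      Nat.card (G.Coloring C) * Nat.card (K.Coloring C) := by
  rw [← Nat.card_prod]
  refine Nat.card_congr
    { toFun := fun c => (⟨c.1 ∘ Sum.inl, fun e h => c.2 (.inl e) ?_⟩,
        ⟨c.1 ∘ Sum.inr, fun e h => c.2 (.inr e) ?_⟩)
      invFun := fun c => ⟨Sum.elim c.1.1 c.2.1, ?_⟩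
      left_inv := fun c => Coloring.ext (by rintro (v | v) <;> rfl)
      right_inv := fun c => rfl }
  · rintro (u | u) hu (v | v) hv
    · exact h u hu v hv
    · exact hv.elim
    · exact hu.elim
    · exact hu.elim
  · rintro (u | u) hu (v | v) hv
    · exact hu.elim
    · exact hu.elim
    · exact hv.elim
    · exact h u hu v hv
  · rintro (e | e) h
    · exact c.1.2 e fun u hu v hv => h (.inl u) hu (.inl v) hv
    · exact c.2.2 e fun u hu v hv => h (.inr u) hu (.inr v) hv

open Classical in
/-- Colorings of the two parts of the vertex set with disjoint sets of colors give a coloring. -/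
def glueColoring (hG : G.NoEmptyEdge) (U : Set G.V) (c : (G.restrict U).Coloring C)
    (d : (G.restrict Uᶜ).Coloring D) : G.Coloring (C ⊕ D) :=
  ⟨fun v => if h : v ∈ U then .inl (c.1 ⟨v, h⟩) else .inr (d.1 ⟨v, h⟩), fun e h => by
    -- An edge monochromatic for the glued map has all its colours in the summand of the colour of
    -- w, so it is a monochromatic edge of one of the restrictions.
    obtain ⟨w, hw⟩ := hG e
    by_cases hwU : w ∈ U
    · have hsub : G.edge e ⊆ U := fun v hv => by
        by_contra hvU
        simpa [hwU, hvU] using h w hw v hv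
      refine c.2 ⟨e, hsub⟩ fun u hu v hv => ?_
      have := h u.1 hu v.1 hv
      dsimp only at this
      rw [dif_pos (hsub hu), dif_pos (hsub hv)] at this
      exact Sum.inl_injective this
    · have hsub : G.edge e ⊆ Uᶜ := fun v hv hvU => by
        simpa [hwU, hvU] using h w hw v hv
      refine d.2 ⟨e, hsub⟩ fun u hu v hv => ?_
      have := h u.1 hu v.1 hv
      dsimp only at this
      rw [dif_neg (hsub hu), dif_neg (hsub hv)] at this
      exact Sum.inr_injective this⟩

theorem glueColoring_of_mem (hG : G.NoEmptyEdge) {U : Set G.V} (c : (G.restrict U).Coloring C)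
    (d : (G.restrict Uᶜ).Coloring D) {v : G.V} (h : v ∈ U) :
    (glueColoring hG U c d).1 v = .inl (c.1 ⟨v, h⟩) := dif_pos h

theorem glueColoring_of_notMem (hG : G.NoEmptyEdge) {U : Set G.V} (c : (G.restrict U).Coloring C)
    (d : (G.restrict Uᶜ).Coloring D) {v : G.V} (h : v ∉ U) :
    (glueColoring hG U c d).1 v = .inr (d.1 ⟨v, h⟩) := dif_neg h

/-- Recovers U from the glued colouring, which is the main point of injectivity. -/
theorem isLeft_glueColoring (hG : G.NoEmptyEdge) (U : Set G.V) (c : (G.restrict U).Coloring C)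
    (d : (G.restrict Uᶜ).Coloring D) : {v | ((glueColoring hG U c d).1 v).isLeft} = U := by
  ext v
  by_cases h : v ∈ U
  · simp [glueColoring_of_mem, h]
  · simp [glueColoring_of_notMem, h]

theorem glueColoring_bijective (hG : G.NoEmptyEdge) : Bijective
    fun p : Σ U : Set G.V, (G.restrict U).Coloring C × (G.restrict Uᶜ).Coloring D =>
      glueColoring hG p.1 p.2.1 p.2.2 := by
  constructor
  · rintro ⟨U, c, d⟩ ⟨U', c', d'⟩ h
    dsimp only at h
    obtain rfl : U = U' := by
      rw [← isLeft_glueColoring hG U c d, h, isLeft_glueColoring]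
    have key : ∀ v, (glueColoring hG U c d).1 v = (glueColoring hG U c' d').1 v := fun v => by rw [h]
    obtain rfl : c = c' := Coloring.ext fun v => by
      have := key v.1
      rw [glueColoring_of_mem hG c d v.2, glueColoring_of_mem hG c' d' v.2] at this
      exact Sum.inl_injective this
    obtain rfl : d = d' := Coloring.ext fun v => by
      have := key v.1
      rw [glueColoring_of_notMem hG c d v.2, glueColoring_of_notMem hG c d' v.2] at this
      exact Sum.inr_injective this
    rfl
  · intro f
    let U : Set G.V := {v | (f.1 v).isLeft}
    have hU : ∀ v, v ∉ U → (f.1 v).isRight := fun v hv => by simpa [U] using hv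
    let c : (G.restrict U).Coloring C := ⟨fun v => (f.1 v.1).getLeft v.2, fun e h => f.2 e.1 ?_⟩
    · let d : (G.restrict Uᶜ).Coloring D :=
        ⟨fun v => (f.1 v.1).getRight (hU v.1 v.2), fun e h => f.2 e.1 ?_⟩
      · refine ⟨⟨U, c, d⟩, Coloring.ext fun v => ?_⟩
        by_cases hv : v ∈ U
        · exact (glueColoring_of_mem hG c d hv).trans (Sum.inl_getLeft _ _)
        · exact (glueColoring_of_notMem hG c d hv).trans (Sum.inr_getRight _ _)
      · intro u hu v hv
        have := h ⟨u, e.2 hu⟩ hu ⟨v, e.2 hv⟩ hv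
        rw [← Sum.inr_getRight (f.1 u) (hU u (e.2 hu)), ← Sum.inr_getRight (f.1 v) (hU v (e.2 hv))]
        exact congrArg Sum.inr this
    · intro u hu v hv
      have := h ⟨u, e.2 hu⟩ hu ⟨v, e.2 hv⟩ hv
      rw [← Sum.inl_getLeft (f.1 u) (e.2 hu), ← Sum.inl_getLeft (f.1 v) (e.2 hv)]
      exact congrArg Sum.inl this

theorem card_coloring_sum (hG : G.NoEmptyEdge) (C D : Type) [Finite C] [Finite D] :
    (Nat.card (G.Coloring (C ⊕ D)) : ℚ) = ∑ᶠ U : Set G.V,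
      (Nat.card ((G.restrict U).Coloring C) : ℚ) * Nat.card ((G.restrict Uᶜ).Coloring D) := by
  have := Fintype.ofFinite (Set G.V)
  rw [← Nat.card_congr (Equiv.ofBijective _ (glueColoring_bijective hG)), Nat.card_sigma,
    finsum_eq_sum_of_fintype]
  simp [Nat.card_prod]

/-- A coloring of `(F, V)` and one of `(Fᶜ, V/F)` give a coloring by pairs. -/
def pairColoring (F : Set G.E) (c : (G.keep F).Coloring C) (d : (G.contract F).Coloring D) :
    G.Coloring (C × D) :=
  ⟨fun v => (c.1 v, d.1 (Quotient.mk _ v)), fun e h => by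
    by_cases he : e ∈ F
    · exact c.2 ⟨e, he⟩ fun u hu v hv => congrArg Prod.fst (h u hu v hv)
    · refine d.2 ⟨e, he⟩ ?_
      rintro _ ⟨u, hu, rfl⟩ _ ⟨v, hv, rfl⟩
      exact congrArg Prod.snd (h u hu v hv)⟩

/-- Edges of F collapse in V/F, so the second coordinate is constant on them; on any other edge it
is not, since d is a colouring of the contraction. Hence F can be read off from the colouring by
pairs. -/
theorem monochromatic_pairColoring (F : Set G.E) (c : (G.keep F).Coloring C)
    (d : (G.contract F).Coloring D) : {e | ∀ u ∈ G.edge e, ∀ v ∈ G.edge e,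
      ((pairColoring F c d).1 u).2 = ((pairColoring F c d).1 v).2} = F := by
  ext e
  constructor
  · intro h
    by_contra he
    refine d.2 ⟨e, he⟩ ?_
    rintro _ ⟨u, hu, rfl⟩ _ ⟨v, hv, rfl⟩
    exact h u hu v hv
  · exact fun he u hu v hv => congrArg d.1 (Quotient.sound (contractSetoid_rel he hu hv))

theorem pairColoring_bijective : Bijective
    fun p : Σ F : Set G.E, (G.keep F).Coloring C × (G.contract F).Coloring D =>
      pairColoring p.1 p.2.1 p.2.2 := by
  constructor
  · rintro ⟨F, c, d⟩ ⟨F', c', d'⟩ h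
    dsimp only at h
    obtain rfl : F = F' := by
      rw [← monochromatic_pairColoring F c d, h, monochromatic_pairColoring]
    have key : ∀ v, (pairColoring F c d).1 v = (pairColoring F c' d').1 v := fun v => by rw [h]
    obtain rfl : c = c' := Coloring.ext fun v => congrArg Prod.fst (key v)
    obtain rfl : d = d' := Coloring.ext fun v => by
      obtain ⟨v, rfl⟩ := Quotient.mk_surjective v
      exact congrArg Prod.snd (key v)
    rfl
  · intro f
    let F : Set G.E := {e | ∀ u ∈ G.edge e, ∀ v ∈ G.edge e, (f.1 u).2 = (f.1 v).2}
    -- The second coordinate descends to V/F. On an edge of F the first coordinate must then vary,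
    -- since the pair does.
    have hF : G.contractSetoid F ≤ Setoid.ker fun v => (f.1 v).2 :=
      contractSetoid_le_iff.2 fun e he => he
    refine ⟨⟨F, ⟨fun v => (f.1 v).1, fun e h => f.2 e.1 fun u hu v hv =>
      Prod.ext (h u hu v hv) (e.2 u hu v hv)⟩,
      ⟨Quotient.lift (fun v => (f.1 v).2) hF, fun e h => e.2 fun u hu v hv => ?_⟩⟩, rfl⟩
    exact h _ ⟨u, hu, rfl⟩ _ ⟨v, hv, rfl⟩

theorem card_coloring_prod (G : FinHypergraph) (C D : Type) [Finite C] [Finite D] :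
    (Nat.card (G.Coloring (C × D)) : ℚ) = ∑ᶠ F : Set G.E,
      (Nat.card ((G.keep F).Coloring C) : ℚ) * Nat.card ((G.contract F).Coloring D) := by
  have := Fintype.ofFinite (Set G.E)
  rw [← Nat.card_congr (Equiv.ofBijective _ pairColoring_bijective), Nat.card_sigma,
    finsum_eq_sum_of_fintype]
  simp [Nat.card_prod]

theorem natCast_card_subtype_eq_sum {α : Type*} [Fintype α] (p : α → Prop) [DecidablePred p] :
    (Nat.card {a // p a} : ℚ) = ∑ a, if p a then 1 else 0 := by
  rw [Nat.card_eq_fintype_card, Fintype.card_subtype, Finset.sum_boole]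

open Polynomial Classical in
-- Inclusion-exclusion: the maps from V to n colours for which every edge of F is monochromatic are
-- the maps from V/F, so their number is a power of n.
theorem exists_isChromaticPolynomial (G : FinHypergraph) : ∃ p : ℚ[X], G.IsChromaticPolynomial p := by
  have := Fintype.ofFinite G.V
  have := Fintype.ofFinite G.E
  refine ⟨∑ F : Finset G.E, (-1) ^ F.card * X ^ Nat.card (Quotient (G.contractSetoid F)),
    fun n => ?_⟩
  -- Obtained from an existential so that the predicate stays opaque while the indicator functions
  -- are manipulated.
  obtain ⟨mono, hmono⟩ : ∃ mono : (G.V → Fin n) → G.E → Prop,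
      ∀ c e, mono c e ↔ ∀ u ∈ G.edge e, ∀ v ∈ G.edge e, c u = c v := ⟨_, fun _ _ => Iff.rfl⟩
  have hcount : ∀ F : Finset G.E, ∑ c : G.V → Fin n, ∏ e ∈ F, (if mono c e then 1 else 0 : ℚ) =
      (n : ℚ) ^ Nat.card (Quotient (G.contractSetoid F)) := by
    intro F
    have : Nat.card {c : G.V → Fin n // ∀ e ∈ F, mono c e} =
        n ^ Nat.card (Quotient (G.contractSetoid F)) := by
      trans Nat.card (Quotient (G.contractSetoid F) → Fin n)
      swap
      · rw [Nat.card_fun, Nat.card_fin]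
      simp only [hmono]
      exact Nat.card_congr ((Equiv.subtypeEquivRight fun c =>
        (contractSetoid_le_iff (F := (F : Set G.E)) (r := Setoid.ker c)).symm).trans
          (Setoid.liftEquiv _))
    rw [← Nat.cast_pow, ← this, natCast_card_subtype_eq_sum]
    refine Finset.sum_congr rfl fun c _ => ?_
    rw [Finset.prod_boole]
    congr
  have hcol : (Nat.card (G.Coloring (Fin n)) : ℚ) =
      ∑ c : G.V → Fin n, ∏ e, (1 - if mono c e then 1 else 0 : ℚ) := by
    have h : ∀ c e, (1 - if mono c e then 1 else 0 : ℚ) = if ¬ mono c e then 1 else 0 :=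
      fun c e => by split_ifs <;> simp_all
    have hcard : Nat.card (G.Coloring (Fin n)) =
        Nat.card {c : G.V → Fin n // ∀ e ∈ Finset.univ, ¬ mono c e} := by
      simp only [Finset.mem_univ, true_imp_iff, hmono]
      rfl
    rw [hcard, natCast_card_subtype_eq_sum]
    refine Finset.sum_congr rfl fun c _ => ?_
    simp only [h]
    rw [Finset.prod_boole]
    congr
  rw [hcol, eval_finsetSum]
  -- Expands the product of the factors 1 minus indicator over all edges into a signed sum over edge
  -- sets F.
  simp only [Finset.prod_sub, Finset.prod_const_one, mul_one, Finset.powerset_univ]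
  rw [Finset.sum_comm]
  refine Finset.sum_congr rfl fun F _ => ?_
  rw [← Finset.mul_sum, hcount]
  simp

end FinHypergraph

/-! ### The chromatic morphism and its uniqueness -/

section ChromaticMorphism

open FinHypergraph Polynomial

/-- The chromatic polynomial of a hypergraph. -/
def FinHypergraph.chromaticPolynomial (G : FinHypergraph) : ℚ[X] :=
  G.exists_isChromaticPolynomial.choose

theorem FinHypergraph.eval_chromaticPolynomial (G : FinHypergraph) (n : ℕ) :
    G.chromaticPolynomial.eval (n : ℚ) = Nat.card (G.Coloring (Fin n)) :=
  G.exists_isChromaticPolynomial.choose_spec n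

/-- The morphism from `H°` to `ℚ[x]` given by the chromatic polynomials. -/
def chromaticHom : HypAlg →ₐ[ℚ] ℚ[X] :=
  MonoidAlgebra.lift ℚ ℚ[X] HypClass
    { toFun := Quotient.lift (fun G : EdgyHypergraph => G.1.chromaticPolynomial) fun G K ⟨f⟩ =>
        ext_of_eval_natCast fun n => by
          simp only [eval_chromaticPolynomial, card_coloring_congr f]
      map_one' := ext_of_eval_natCast fun n => by
        refine (eval_chromaticPolynomial _ n).trans ?_
        rw [card_coloring_of_isEmpty (G := EdgyHypergraph.empty.1)]
        simp
      map_mul' := fun a b => by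
        induction a using Quotient.inductionOn with | h G => ?_
        induction b using Quotient.inductionOn with | h K => ?_
        refine ext_of_eval_natCast fun n => (eval_chromaticPolynomial _ n).trans ?_
        rw [eval_mul]
        refine Eq.trans ?_ (congrArg₂ (· * ·) (eval_chromaticPolynomial G.1 n)
          (eval_chromaticPolynomial K.1 n)).symm
        rw [← Nat.cast_mul, ← card_coloring_disjUnion]
        rfl }

theorem chromaticHom_ofHyp (G : EdgyHypergraph) :
    chromaticHom (HypAlg.ofHyp G) = G.1.chromaticPolynomial := by
  unfold chromaticHom HypAlg.ofHyp
  rw [MonoidAlgebra.lift_of]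
  rfl

/-- After evaluation the four identities count colourings with m + n, 0, mn and 1 colours. No
colours suffice only when there is no vertex; with a single colour every edge is monochromatic, so
there must be no edge. -/
theorem chromaticHom_isDoubleBialgebraHom :
    IsDoubleBialgebraHom hypDouble polyDouble chromaticHom where
  map_Δ := by
    refine HypAlg.linearMap_ext fun G => tensor_ext_of_evalTensor fun m n => ?_
    have h : hypDouble.Δ (HypAlg.ofHyp G) = HypAlg.resSum G := HypAlg.comulRes_ofHyp G
    simp only [LinearMap.comp_apply, AlgHom.toLinearMap_apply, evalTensor_comul_add, h,
      HypAlg.resSum, map_finsum_of_finite, TensorProduct.map_tmul, evalTensor_tmul,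
      chromaticHom_ofHyp, eval_chromaticPolynomial]
    rw [← card_coloring_congr_right finSumFinEquiv, card_coloring_sum G.2]
    rfl
  map_εΔ := by
    classical
    refine HypAlg.linearMap_ext fun G => ?_
    have h : polyDouble.εΔ (chromaticHom (HypAlg.ofHyp G)) =
        (chromaticHom (HypAlg.ofHyp G)).eval ((0 : ℕ) : ℚ) := by
      simp [polyDouble, coe_aeval_eq_eval]
    refine h.trans ?_
    rw [chromaticHom_ofHyp, eval_chromaticPolynomial]
    refine Eq.trans ?_ (HypAlg.counitRes_ofHyp G).symm
    split_ifs with hV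
    · have := HypAlg.isEmpty_edges G
      rw [card_coloring_of_isEmpty, Nat.cast_one]
    · have : IsEmpty (G.1.Coloring (Fin 0)) := ⟨fun c => hV ⟨fun v => (c.1 v).elim0⟩⟩
      rw [Nat.card_of_isEmpty, Nat.cast_zero]
  map_δ := by
    refine HypAlg.linearMap_ext fun G => tensor_ext_of_evalTensor fun m n => ?_
    have h : hypDouble.δ (HypAlg.ofHyp G) = HypAlg.extSum G := HypAlg.comulExt_ofHyp G
    simp only [LinearMap.comp_apply, AlgHom.toLinearMap_apply, evalTensor_comul_mul, h,
      HypAlg.extSum, map_finsum_of_finite, TensorProduct.map_tmul, evalTensor_tmul,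
      chromaticHom_ofHyp, eval_chromaticPolynomial]
    rw [← card_coloring_congr_right finProdFinEquiv, card_coloring_prod]
    rfl
  map_εδ := by
    classical
    refine HypAlg.linearMap_ext fun G => ?_
    have h : polyDouble.εδ (chromaticHom (HypAlg.ofHyp G)) =
        (chromaticHom (HypAlg.ofHyp G)).eval ((1 : ℕ) : ℚ) := by
      simp [polyDouble, coe_aeval_eq_eval]
    refine h.trans ?_
    rw [chromaticHom_ofHyp, eval_chromaticPolynomial]
    refine Eq.trans ?_ (HypAlg.counitExt_ofHyp G).symm
    split_ifs with hE
    · have : Unique (G.1.Coloring (Fin 1)) :=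
        { default := ⟨fun _ => 0, fun e => (hE.false e).elim⟩
          uniq := fun c => Coloring.ext fun v => Subsingleton.elim _ _ }
      rw [Nat.card_unique, Nat.cast_one]
    · have : IsEmpty (G.1.Coloring (Fin 1)) :=
        ⟨fun c => hE ⟨fun e => c.2 e fun _ _ _ _ => Subsingleton.elim _ _⟩⟩
      rw [Nat.card_of_isEmpty, Nat.cast_zero]

/-- A morphism `φ` to `ℚ[x]` is determined by the structure maps of its source: evaluating at `0`
and at `1` gives the counits, and evaluating at `n + 1` is evaluating at `n` and at `1` after `Δ`. -/
theorem IsDoubleBialgebraHom.polynomial_unique {B : Type*} [CommRing B] [Algebra ℚ B]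
    {S : DoubleComul B} {φ ψ : B →ₐ[ℚ] ℚ[X]} (hφ : IsDoubleBialgebraHom S polyDouble φ)
    (hψ : IsDoubleBialgebraHom S polyDouble ψ) : φ = ψ := by
  have hzero : ∀ p : ℚ[X], polyDouble.εΔ p = p.eval ((0 : ℕ) : ℚ) := fun p => by
    simp [polyDouble, coe_aeval_eq_eval]
  have hone : ∀ p : ℚ[X], polyDouble.εδ p = p.eval ((1 : ℕ) : ℚ) := fun p => by
    simp [polyDouble, coe_aeval_eq_eval]
  have h₁ : ∀ b, (φ b).eval ((1 : ℕ) : ℚ) = (ψ b).eval ((1 : ℕ) : ℚ) := fun b => by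
    rw [← hone, ← hone]
    exact LinearMap.congr_fun (hφ.map_εδ.trans hψ.map_εδ.symm) b
  have key : ∀ (n : ℕ) (b : B), (φ b).eval (n : ℚ) = (ψ b).eval (n : ℚ) := by
    intro n
    induction n with
    | zero =>
      intro b
      rw [← hzero, ← hzero]
      exact LinearMap.congr_fun (hφ.map_εΔ.trans hψ.map_εΔ.symm) b
    | succ n ih =>
      intro b
      rw [← evalTensor_comul_add, ← evalTensor_comul_add]
      -- On pure tensors evaluation at (n, 1) involves only the values at n and at 1, where the two
      -- morphisms agree; by linearity they agree on the whole tensor square, in particular on Δ b.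
      have hmap : (evalTensor n 1).toLinearMap ∘ₗ
          TensorProduct.map φ.toLinearMap φ.toLinearMap =
          (evalTensor n 1).toLinearMap ∘ₗ TensorProduct.map ψ.toLinearMap ψ.toLinearMap :=
        TensorProduct.ext' fun x y => by
          simp only [LinearMap.comp_apply, TensorProduct.map_tmul, AlgHom.toLinearMap_apply,
            evalTensor_tmul, ih, h₁]
      have hφb := LinearMap.congr_fun hφ.map_Δ b
      have hψb := LinearMap.congr_fun hψ.map_Δ b
      simp only [LinearMap.comp_apply, AlgHom.toLinearMap_apply] at hφb hψb
      rw [hφb, hψb]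
      exact LinearMap.congr_fun hmap (S.Δ b)
  exact AlgHom.ext fun b => ext_of_eval_natCast fun n => key n b

end ChromaticMorphism

end

theorem theorem6p4 :
    hypDouble.IsDoubleBialgebra ∧ polyDouble.IsDoubleBialgebra ∧
      ∃ χ : HypAlg →ₐ[ℚ] ℚ[X],
        IsDoubleBialgebraHom hypDouble polyDouble χ ∧
        (∀ ψ : HypAlg →ₐ[ℚ] ℚ[X], IsDoubleBialgebraHom hypDouble polyDouble ψ → ψ = χ) ∧
        ∀ G : EdgyHypergraph, G.1.IsChromaticPolynomial (χ (HypAlg.ofHyp G)) := by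
  refine ⟨hypDouble_isDoubleBialgebra, polyDouble_isDoubleBialgebra, chromaticHom,
    chromaticHom_isDoubleBialgebraHom,
    fun ψ hψ => hψ.polynomial_unique chromaticHom_isDoubleBialgebraHom, fun G n => ?_⟩
  rw [chromaticHom_ofHyp, FinHypergraph.eval_chromaticPolynomial]
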